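/- Let $p\ge 0$, let $\beta_1,\dots,\beta_p\in\mathbb{C}$ with $|\beta_k|<1$ be such that $L_Z(z)=\prod_{k=1}^p(1+\beta_k z)$ has real coefficients, and let $\{Z_i\}_{i\ge1}$ be a real zero-mean stationary Gaussian process with power spectral density $S_Z(e^{i\theta})=1/|L_Z(e^{i\theta})|^2$, i.e. $\mathbb{E}[Z_jZ_k]=\frac1{2\pi}\int_{-\pi}^{\pi}e^{i(j-k)\theta}S_Z(e^{i\theta})\,d\theta$. Let $U_1,U_2$ be independent standard normal variables, independent of $\{Z_i\}$. For $a,b\in\mathbb{R}$ the SK(2) scheme over the channel $Y_i=X_i+Z_i$ with feedback has the message process $V_1=U_1$, $V_2=U_2$, $V_{i+1}=aV_i+bV_{i-1}$ $(i\ge2)$ and the inputs $X_1=U_1$, $X_2=U_2$, $X_i=V_i-\mathbb{E}[V_i\mid Y_1,\dots,Y_{i-1}]$ $(i\ge3)$. Let $\gamma_1,\gamma_2\in\mathbb{C}$ denote the roots of $\lambda^2-a\lambda-b=0$. For $\gamma_1\ne\gamma_2$, $|\gamma_1|,|\gamma_2|>1$ put $$c_1=\frac1{\gamma_1(\gamma_1-\gamma_2)},\quad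 c_2=\frac1{\gamma_2(\gamma_2-\gamma_1)},\quad L_{ij}=\frac{c_ic_jL_Z(\gamma_i^{-1})L_Z(\gamma_j^{-1})}{\gamma_i\gamma_j-1},\quad \Delta=(\gamma_1-\gamma_2)^2(L_{11}L_{22}-L_{12}^2),$$ $$f(\gamma_1,\gamma_2)=\frac1\Delta\left(\frac{L_{11}}{\gamma_2^2}+\frac{L_{22}}{\gamma_1^2}+\frac{2L_{12}}{\gamma_1\gamma_2}\right).$$ If $\gamma_1\neq\gamma_2$ are the roots, of modulus greater than $1$, of such a real quadratic, then $f(\gamma_1,\gamma_2)$ is real. For real $\gamma$ with $|\gamma|>1$, the limit $f(\gamma,\gamma):=\lim_{\gamma_1\to\gamma,\ \gamma_1\ne\gamma}f(\gamma_1,\gamma)$ (with $\gamma_1\in\mathbb{C}$) exists and equals $$\frac{(\gamma^2-1)^3L_Z'(\gamma^{-1})^2}{\gamma^4L_Z(\gamma^{-1})^4}+\frac{2(\gamma^2-1)^2}{\gamma}\,\frac{L_Z'(\gamma^{-1})}{L_Z(\gamma^{-1})^3}+\frac{\gamma^4-1}{L_Z(\gamma^{-1})^2}.$$ Let $P>0$.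 Call the scheme feasible if $b\neq0$, $|\gamma_1|>1$, $|\gamma_2|>1$ and $f(\gamma_1,\gamma_2)\le P$ (repeated roots allowed). Then every feasible scheme satisfies the asymptotic average power constraint $\limsup_{n\to\infty}\frac1n\sum_{i=1}^n\mathbb{E}[X_i^2]\le P$ and achieves the rate $2\log(|\gamma_1|\wedge|\gamma_2|)$: the mutual information rate $\lim_{n\to\infty}\frac1nI(V_1^n;Y_1^n)$ exists and is at least $2\log(|\gamma_1|\wedge|\gamma_2|)$. Moreover the maximum $$\bar I_{\mathrm{SK2}}(P)=\max\{2\log(|\gamma_1|\wedge|\gamma_2|)\;:\;b\ne0,\ |\gamma_1|>1,\ |\gamma_2|>1,\ f(\gamma_1,\gamma_2)\le P\}$$ over the root pairs of such real quadratics is attained, so that some SK(2) scheme with $b\neq0$ satisfies the power constraint and achieves the rate $\bar I_{\mathrm{SK2}}(P)$. -/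

import Mathlib

open MeasureTheory ProbabilityTheory Filter Topology
open scoped ENNReal

namespace SK2

/-! ### The AR(p) Gaussian noise -/

/-- The polynomial `L_Z(z) = ∏ₖ (1 + βₖ z)`. -/
noncomputable def arPoly {p : ℕ} (β : Fin p → ℂ) : Polynomial ℂ :=
  ∏ k, (1 + Polynomial.C (β k) * Polynomial.X)

/-- `β` is the parameter family of a real AR(p) process: every parameter has modulus less than `1`,
and the autoregressive polynomial has real coefficients (the parameters are real or come in
conjugate pairs). -/
structure IsARParam {p : ℕ} (β : Fin p → ℂ) : Prop where
  norm_lt_one : ∀ k, ‖β k‖ < 1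
  real_coeff : ∀ j, ((arPoly β).coeff j).im = 0

/-- The power spectral density `S_Z(e^{iθ}) = 1 / |L_Z(e^{iθ})|²`. -/
noncomputable def arSpectrum {p : ℕ} (β : Fin p → ℂ) (θ : ℝ) : ℝ :=
  1 / ‖(arPoly β).eval (Complex.exp (θ * Complex.I))‖ ^ 2

/-- `Z` is a zero-mean stationary Gaussian process with power spectral density `arSpectrum β`: its
covariances are the Fourier coefficients of the spectral density. White noise of unit variance has
spectral density `1`. -/
structure IsARNoise {Ω : Type*} [MeasurableSpace Ω] (μ : Measure Ω) {p : ℕ} (β : Fin p → ℂ)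
    (Z : ℕ → Ω → ℝ) : Prop where
  measurable : ∀ i, Measurable (Z i)
  gaussian : IsGaussianProcess Z μ
  mean_zero : ∀ i, ∫ ω, Z i ω ∂μ = 0
  covariance_eq : ∀ i j, ((∫ ω, Z i ω * Z j ω ∂μ : ℝ) : ℂ) =
    1 / (2 * Real.pi) * ∫ θ in (-Real.pi)..Real.pi,
      Complex.exp (((i : ℂ) - (j : ℂ)) * θ * Complex.I) * (arSpectrum β θ : ℂ)

/-! ### The coding scheme

Time is counted from `0`: index `n` below is time `n + 1` in the usual description. -/

/-- The initial symbols: two independent standard normal variables, independent of the noise. -/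
structure IsMessage {Ω : Type*} [MeasurableSpace Ω] (μ : Measure Ω) (Z : ℕ → Ω → ℝ)
    (U₁ U₂ : Ω → ℝ) : Prop where
  measurable_fst : Measurable U₁
  measurable_snd : Measurable U₂
  law_fst : HasLaw U₁ (gaussianReal 0 1) μ
  law_snd : HasLaw U₂ (gaussianReal 0 1) μ
  indep : IndepFun U₁ U₂ μ
  indep_noise : IndepFun (fun ω => (U₁ ω, U₂ ω)) (fun ω i => Z i ω) μ

/-- The message process `V`: it starts with `U₁, U₂` and obeys `V_{i+1} = a V_i + b V_{i-1}`. -/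
def message {Ω : Type*} (a b : ℝ) (U₁ U₂ : Ω → ℝ) : ℕ → Ω → ℝ
  | 0 => U₁
  | 1 => U₂
  | n + 2 => fun ω => a * message a b U₁ U₂ (n + 1) ω + b * message a b U₁ U₂ n ω

/-- The channel output `Y = X + Z`, where the first two inputs are the first two values of `V`, and
afterwards the input is `V n` minus its conditional expectation given the previous outputs. -/
noncomputable def output {Ω : Type*} [MeasurableSpace Ω] (μ : Measure Ω) (V Z : ℕ → Ω → ℝ) :
    ℕ → Ω → ℝ
  | n => fun ω =>
      (if n < 2 then V n ω
        else V n ω - (μ[V n | ⨆ j : Fin n,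
          MeasurableSpace.comap (output μ V Z j.1) inferInstance]) ω) + Z n ω
termination_by n => n
decreasing_by exact j.2

/-- The channel input `X`. -/
noncomputable def input {Ω : Type*} [MeasurableSpace Ω] (μ : Measure Ω) (V Z : ℕ → Ω → ℝ)
    (n : ℕ) (ω : Ω) : ℝ :=
  if n < 2 then V n ω
  else V n ω - (μ[V n | ⨆ j : Fin n,
    MeasurableSpace.comap (output μ V Z j.1) inferInstance]) ω

theorem output_eq {Ω : Type*} [MeasurableSpace Ω] (μ : Measure Ω) (V Z : ℕ → Ω → ℝ)
    (n : ℕ) (ω : Ω) : output μ V Z n ω = input μ V Z n ω + Z n ω := by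
  rw [output, input]

/-! ### Power and mutual information rate -/

/-- `limsup_n (1/n) ∑_{i ≤ n} E[X_i²]`, the asymptotic average power. -/
noncomputable def asympPower {Ω : Type*} [MeasurableSpace Ω] (μ : Measure Ω) (X : ℕ → Ω → ℝ) :
    ℝ≥0∞ :=
  limsup (fun n : ℕ =>
    (∑ i ∈ Finset.range n, ∫⁻ ω, ENNReal.ofReal (X i ω ^ 2) ∂μ) / (n : ℝ≥0∞)) atTop

/-- The mutual information of two random variables (in nats): the divergence of the joint law from
the product of the marginal laws. -/
noncomputable def mutualInfo {Ω E F : Type*} [MeasurableSpace Ω] [MeasurableSpace E]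
    [MeasurableSpace F] (μ : Measure Ω) (A : Ω → E) (B : Ω → F) : ℝ≥0∞ :=
  InformationTheory.klDiv (μ.map (fun ω => (A ω, B ω))) ((μ.map A).prod (μ.map B))

/-- `I` is the mutual information rate `lim_n (1/n) I(V_1^n; Y_1^n)` of two processes. -/
def HasMutualInfoRate {Ω : Type*} [MeasurableSpace Ω] (μ : Measure Ω) (V Y : ℕ → Ω → ℝ)
    (I : ℝ≥0∞) : Prop :=
  Tendsto (fun n : ℕ =>
    mutualInfo μ (fun ω (i : Fin n) => V i ω) (fun ω (i : Fin n) => Y i ω) / (n : ℝ≥0∞))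
    atTop (𝓝 I)

/-- The SK(2) scheme with parameters `a, b` satisfies the asymptotic average power constraint `P`
and has a mutual information rate, which is at least `R`. -/
def Achieves {Ω : Type*} [MeasurableSpace Ω] (μ : Measure Ω) (Z : ℕ → Ω → ℝ) (U₁ U₂ : Ω → ℝ)
    (a b P R : ℝ) : Prop :=
  asympPower μ (input μ (message a b U₁ U₂) Z) ≤ ENNReal.ofReal P ∧
  ∃ I : ℝ≥0∞,
    HasMutualInfoRate μ (message a b U₁ U₂) (output μ (message a b U₁ U₂) Z) I ∧
    ENNReal.ofReal R ≤ I

/-! ### The closed-form power expression -/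

/-- `c₁ = coef γ₁ γ₂` and `c₂ = coef γ₂ γ₁`. -/
noncomputable def coef (x y : ℂ) : ℂ := 1 / (x * (x - y))

/-- The numbers `L_{ij}`, with `c, d` the coefficients `c_i, c_j` and `x, y` the roots
`γ_i, γ_j`. -/
noncomputable def Lentry {p : ℕ} (β : Fin p → ℂ) (c d x y : ℂ) : ℂ :=
  c * d * (arPoly β).eval x⁻¹ * (arPoly β).eval y⁻¹ / (x * y - 1)

/-- `(1/Δ) (L₁₁/γ₂² + L₂₂/γ₁² + 2 L₁₂/(γ₁γ₂))` with `Δ = (γ₁ - γ₂)² (L₁₁ L₂₂ - L₁₂²)`,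
for `γ₁ ≠ γ₂`. -/
noncomputable def powerExpr {p : ℕ} (β : Fin p → ℂ) (γ₁ γ₂ : ℂ) : ℂ :=
  let c₁ := coef γ₁ γ₂
  let c₂ := coef γ₂ γ₁
  let L₁₁ := Lentry β c₁ c₁ γ₁ γ₁
  let L₁₂ := Lentry β c₁ c₂ γ₁ γ₂
  let L₂₂ := Lentry β c₂ c₂ γ₂ γ₂
  let Δ := (γ₁ - γ₂) ^ 2 * (L₁₁ * L₂₂ - L₁₂ ^ 2)
  1 / Δ * (L₁₁ / γ₂ ^ 2 + L₂₂ / γ₁ ^ 2 + 2 * L₁₂ / (γ₁ * γ₂))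

/-- The value of the power expression at a repeated root `γ`. -/
noncomputable def powerExprRepeated {p : ℕ} (β : Fin p → ℂ) (γ : ℂ) : ℂ :=
  let L := (arPoly β).eval γ⁻¹
  let L' := (arPoly β).derivative.eval γ⁻¹
  (γ ^ 2 - 1) ^ 3 * L' ^ 2 / (γ ^ 4 * L ^ 4) + 2 * (γ ^ 2 - 1) ^ 2 / γ * (L' / L ^ 3)
    + (γ ^ 4 - 1) / L ^ 2

open Classical in
/-- The power of the scheme with characteristic roots `γ₁, γ₂`. The complex expressions are real
for the roots of a real quadratic. -/
noncomputable def power {p : ℕ} (β : Fin p → ℂ) (γ₁ γ₂ : ℂ) : ℝ :=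
  if γ₁ = γ₂ then (powerExprRepeated β γ₁).re else (powerExpr β γ₁ γ₂).re

/-- `γ₁, γ₂` are the two roots, with multiplicity, of `λ² - a λ - b`. -/
def AreCharRoots (a b : ℝ) (γ₁ γ₂ : ℂ) : Prop :=
  ∀ x : ℂ, x ^ 2 - a * x - b = (x - γ₁) * (x - γ₂)

/-- The pairs over which the rate is maximised: the characteristic roots of a recursion with real
`a` and real `b ≠ 0`, outside the closed unit disc, satisfying the power constraint. -/
def Feasible {p : ℕ} (β : Fin p → ℂ) (P a b : ℝ) (γ₁ γ₂ : ℂ) : Prop :=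
  b ≠ 0 ∧ AreCharRoots a b γ₁ γ₂ ∧ 1 < ‖γ₁‖ ∧ 1 < ‖γ₂‖ ∧ power β γ₁ γ₂ ≤ P

/-- `2 log (|γ₁| ∧ |γ₂|)`. -/
noncomputable def rate (γ₁ γ₂ : ℂ) : ℝ := 2 * Real.log (min ‖γ₁‖ ‖γ₂‖)

/-- The rates `2 log (|γ₁| ∧ |γ₂|)` of all feasible pairs. -/
def feasibleRates {p : ℕ} (β : Fin p → ℂ) (P : ℝ) : Set ℝ :=
  {R | ∃ (a b : ℝ) (γ₁ γ₂ : ℂ), Feasible β P a b γ₁ γ₂ ∧ R = rate γ₁ γ₂}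

end SK2

/-! The inputs differ from the `V n` only by functions of past outputs, so the outputs generate the
same σ-algebras as the open-loop observations `V j + Z j` (`history_output`). All variables are
jointly Gaussian, hence conditional expectations are least squares estimates in `L²`. The input at
time `n ≥ 2` is the estimation error of `V n`, and the mutual information is `-(1/2) log` of the
determinant of the error covariance of the two initial symbols.

Applying the filter `L_Z` to the observations turns the noise into unit white noise for `n ≥ p`, and
the filtered message is a fixed linear form `u` in `(V n, V (n + 1))`, because the recursion can be
run backwards when `b ≠ 0`. The error covariance `Q n` of that pair obeys a Riccati recursion, which
is affine for the inverses: `Q(n+1)⁻¹ = C (Q(n)⁻¹ + u uᵀ) Cᵀ`, with `C` the inverse companion matrix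
(`IsLinearModel.errCov_inv_succ`). The eigenvalues of `C` are the inverse roots, inside the unit
disc, so `Q(n)⁻¹` converges to the unique fixed point `N`, whatever the start
(`tendsto_of_lyapStep`). This fixed point is explicit and positive definite (`exists_lyapLimit`),
and the limiting power `N 1 1 / N.det` is the closed form (`AreCharRoots.power_eq_div`). Cesàro
averaging then gives the average power.

The pair `(V n, V (n + 1))` is the image of the initial symbols under a map of determinant `± b ^
n`. As `det (Q n)` has a positive limit, the mutual information rate is `log |b| = log |γ₁ γ₂|`,
which is at least `2 log (|γ₁| ∧ |γ₂|)` (`hasMutualInfoRate`, `rate_le_log`).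

In terms of the inverse roots and of divided differences of `L_Z`, the power is a quotient of
functions that stay continuous when the roots coalesce. This gives the limit at a repeated root, and
the maximum follows by compactness (`exists_isGreatest`): pairs with an inverse root equal to `0`
violate the constraint, since there the denominator vanishes and the numerator is positive. -/

namespace SK2

/-! ### The closed form of the power expression -/

section ClosedForm

variable {p : ℕ} (β : Fin p → ℂ)

theorem natDegree_arPoly_le : (arPoly β).natDegree ≤ p := by
  unfold arPoly
  refine (Polynomial.natDegree_prod_le _ _).trans ?_
  refine (Finset.sum_le_card_nsmul _ _ 1 fun k _ => ?_).trans (by simp)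
  compute_degree

theorem eval_arPoly (z : ℂ) :
    (arPoly β).eval z = ∑ k ∈ Finset.range (p + 1), (arPoly β).coeff k * z ^ k :=
  Polynomial.eval_eq_sum_range' (Nat.lt_succ_of_le (natDegree_arPoly_le β)) z

theorem arPoly_coeff_zero : (arPoly β).coeff 0 = 1 := by
  rw [Polynomial.coeff_zero_eq_eval_zero]
  simp [arPoly, Polynomial.eval_prod]

variable {β}

theorem IsARParam.eval_ne_zero (hβ : IsARParam β) {z : ℂ} (hz : ‖z‖ ≤ 1) :
    (arPoly β).eval z ≠ 0 := by
  simp only [arPoly, Polynomial.eval_prod, Polynomial.eval_add, Polynomial.eval_one,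
    Polynomial.eval_mul, Polynomial.eval_C, Polynomial.eval_X]
  refine Finset.prod_ne_zero_iff.2 fun k _ h => ?_
  have h1 : ‖β k * z‖ = 1 := by
    rw [eq_neg_of_add_eq_zero_right h, norm_neg, norm_one]
  rw [norm_mul] at h1
  have := hβ.norm_lt_one k
  nlinarith [norm_nonneg (β k), norm_nonneg z]

theorem IsARParam.coeff_eq (hβ : IsARParam β) (k : ℕ) :
    (arPoly β).coeff k = (((arPoly β).coeff k).re : ℂ) :=
  Complex.ext rfl (by simp [hβ.real_coeff k])

theorem IsARParam.conj_eval (hβ : IsARParam β) (z : ℂ) :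
    (starRingEnd ℂ) ((arPoly β).eval z) = (arPoly β).eval ((starRingEnd ℂ) z) := by
  simp only [eval_arPoly, map_sum, map_mul, map_pow]
  refine Finset.sum_congr rfl fun k _ => ?_
  rw [hβ.coeff_eq k, Complex.conj_ofReal]

theorem IsARParam.eval_ofReal (hβ : IsARParam β) (x : ℝ) :
    (arPoly β).eval (x : ℂ) = (((arPoly β).eval (x : ℂ)).re : ℂ) := by
  rw [eq_comm, ← Complex.conj_eq_iff_re, hβ.conj_eval, Complex.conj_ofReal]

/-- The complete homogeneous symmetric polynomial of degree `k - 1` in two variables. -/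
noncomputable def geom (k : ℕ) (s t : ℂ) : ℂ := ∑ i ∈ Finset.range k, s ^ i * t ^ (k - 1 - i)

theorem geom_succ (k : ℕ) (s t : ℂ) : geom (k + 1) s t = t ^ k + s * geom k s t := by
  unfold geom
  rw [Finset.sum_range_succ', Finset.mul_sum, add_comm]
  simp only [pow_zero, one_mul, Nat.sub_zero, Nat.add_sub_cancel]
  congr 1
  refine Finset.sum_congr rfl fun i hi => ?_
  rw [pow_succ', mul_assoc]
  congr 3
  omega

theorem geom_mul_sub (k : ℕ) (s t : ℂ) : geom k s t * (s - t) = s ^ k - t ^ k :=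
  (Commute.all s t).geom_sum₂_mul k

theorem geom_self (k : ℕ) (t : ℂ) : geom k t t = k * t ^ (k - 1) := by
  unfold geom
  rw [Finset.sum_congr rfl (g := fun _ => t ^ (k - 1))]
  · simp
  · intro i hi
    rw [← pow_add]
    congr 1
    have := Finset.mem_range.1 hi
    omega

theorem continuous_geom (k : ℕ) : Continuous fun x : ℂ × ℂ => geom k x.1 x.2 := by
  unfold geom
  fun_prop

theorem tendsto_geom {s t : ℂ} (hs : ‖s‖ < 1) (ht : ‖t‖ < 1) :
    Tendsto (fun k => geom k s t) atTop (𝓝 0) := by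
  rw [← tendsto_add_atTop_iff_nat 1]
  set r := max ‖s‖ ‖t‖
  have hr0 : 0 ≤ r := (norm_nonneg s).trans (le_max_left _ _)
  have hr : r < 1 := max_lt hs ht
  refine squeeze_zero_norm (a := fun k : ℕ => (k : ℝ) * r ^ k + r ^ k) (fun k => ?_) ?_
  · refine (norm_sum_le _ _).trans ?_
    refine (Finset.sum_le_card_nsmul _ _ (r ^ k) fun i hi => ?_).trans ?_
    · have hi := Finset.mem_range.1 hi
      rw [norm_mul, norm_pow, norm_pow]
      calc ‖s‖ ^ i * ‖t‖ ^ (k + 1 - 1 - i) ≤ r ^ i * r ^ (k + 1 - 1 - i) := by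
            gcongr
            · exact le_max_left _ _
            · exact le_max_right _ _
        _ = r ^ k := by rw [← pow_add]; congr 1; omega
    · simp
      ring_nf
      rfl
  · simpa using (tendsto_self_mul_const_pow_of_lt_one hr0 hr).add
      (tendsto_pow_atTop_nhds_zero_of_lt_one hr0 hr)

variable (β) in
/-- The divided difference of the autoregressive polynomial. -/
noncomputable def divDiff (s t : ℂ) : ℂ :=
  ∑ k ∈ Finset.range (p + 1), (arPoly β).coeff k * geom k s t

variable (β) in
theorem divDiff_mul_sub (s t : ℂ) :
    divDiff β s t * (s - t) = (arPoly β).eval s - (arPoly β).eval t := by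
  simp only [divDiff, Finset.sum_mul, mul_assoc, geom_mul_sub]
  simp only [eval_arPoly, mul_sub, Finset.sum_sub_distrib]

variable (β) in
theorem eval_eq_add_divDiff (s t : ℂ) :
    (arPoly β).eval s = (arPoly β).eval t + (s - t) * divDiff β s t := by
  linear_combination -divDiff_mul_sub β s t

variable (β) in
theorem divDiff_self (t : ℂ) : divDiff β t t = (arPoly β).derivative.eval t := by
  rw [Polynomial.derivative_eval, Polynomial.sum_over_range' _ (by simp) (p + 1)
    (Nat.lt_succ_of_le (natDegree_arPoly_le β))]
  simp only [divDiff, geom_self, mul_assoc]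

variable (β) in
theorem continuous_divDiff : Continuous fun x : ℂ × ℂ => divDiff β x.1 x.2 := by
  unfold divDiff
  exact continuous_finsetSum _ fun k _ => continuous_const.mul (continuous_geom k)

/-- Coordinates of `N + u uᵀ`, where `N` is the solution of `N = C (N + u uᵀ) Cᵀ`, in the basis
that makes `C` lower triangular with diagonal `t, s`. -/
noncomputable def coordA (ℓ t : ℂ) : ℂ := ℓ ^ 2 / (1 - t ^ 2)

/-- See `coordA`. -/
noncomputable def coordB (ℓ D s t : ℂ) : ℂ := (t * coordA ℓ t + ℓ * D) / (1 - s * t)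

/-- The last coordinate of the solution `N` itself. -/
noncomputable def coordN (ℓ D s t : ℂ) : ℂ :=
  (coordA ℓ t + 2 * s * coordB ℓ D s t + s ^ 2 * D ^ 2) / (1 - s ^ 2)

/-- The determinant of the coordinate matrix of the solution `N`. -/
noncomputable def coordDet (ℓ D s t : ℂ) : ℂ :=
  t ^ 2 * coordA ℓ t * coordN ℓ D s t - (coordB ℓ D s t - ℓ * D) ^ 2

theorem one_sub_ne_zero_of_norm_lt {z : ℂ} (hz : ‖z‖ < 1) : 1 - z ≠ 0 := by
  intro h
  rw [← sub_eq_zero.1 h, norm_one] at hz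
  exact lt_irrefl _ hz

theorem one_sub_mul_ne_zero {s t : ℂ} (hs : ‖s‖ < 1) (ht : ‖t‖ < 1) : 1 - s * t ≠ 0 :=
  one_sub_ne_zero_of_norm_lt (by
    rw [norm_mul]; exact mul_lt_one_of_nonneg_of_lt_one_left (norm_nonneg _) hs ht.le)

theorem one_sub_sq_ne_zero {s : ℂ} (hs : ‖s‖ < 1) : 1 - s ^ 2 ≠ 0 := by
  rw [sq]; exact one_sub_mul_ne_zero hs hs

/-- When `D` is a divided difference with nodes `s, t` and `ℓ` the value at `t`, the factor `ℓ + (s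
- t) D` is the value at `s`. The determinant is therefore nonzero for nonzero `s, t` in the disc,
including `s = t`. -/
theorem coordDet_eq (ℓ D : ℂ) {s t : ℂ} (hs : ‖s‖ < 1) (ht : ‖t‖ < 1) :
    coordDet ℓ D s t = s ^ 2 * t ^ 2 * ℓ ^ 2 * (ℓ + (s - t) * D) ^ 2 /
      ((1 - s ^ 2) * (1 - t ^ 2) * (1 - s * t) ^ 2) := by
  have h1 := one_sub_sq_ne_zero hs
  have h2 := one_sub_sq_ne_zero ht
  have h3 := one_sub_mul_ne_zero hs ht
  have h3' : 1 - t * s ≠ 0 := by rwa [mul_comm]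
  unfold coordDet coordN coordB coordA
  rw [mul_comm s t]
  field_simp
  ring

variable (β) in
-- The original expression has `γ₁ - γ₂` in its denominators. Replacing the value of `L_Z` at the
-- first inverse root by its Newton form at the second removes this singularity.
theorem powerExpr_eq {x y : ℂ} (hx : 1 < ‖x‖) (hy : 1 < ‖y‖) (hxy : x ≠ y)
    (hLx : (arPoly β).eval x⁻¹ ≠ 0) (hLy : (arPoly β).eval y⁻¹ ≠ 0) :
    powerExpr β x y = coordN ((arPoly β).eval y⁻¹) (divDiff β x⁻¹ y⁻¹) x⁻¹ y⁻¹ /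
      coordDet ((arPoly β).eval y⁻¹) (divDiff β x⁻¹ y⁻¹) x⁻¹ y⁻¹ := by
  have hx0 : x ≠ 0 := by rintro rfl; norm_num at hx
  have hy0 : y ≠ 0 := by rintro rfl; norm_num at hy
  have hs : ‖x⁻¹‖ < 1 := by rw [norm_inv]; exact inv_lt_one_of_one_lt₀ hx
  have ht : ‖y⁻¹‖ < 1 := by rw [norm_inv]; exact inv_lt_one_of_one_lt₀ hy
  have h1 := one_sub_sq_ne_zero hs
  have h2 := one_sub_sq_ne_zero ht
  have h3 := one_sub_mul_ne_zero hs ht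
  have e := eval_eq_add_divDiff β x⁻¹ y⁻¹
  have hD : divDiff β x⁻¹ y⁻¹ =
      ((arPoly β).eval x⁻¹ - (arPoly β).eval y⁻¹) * (x * y) / (y - x) := by
    rw [e]
    have : y - x ≠ 0 := sub_ne_zero.2 hxy.symm
    field_simp
    ring
  rw [coordDet_eq _ _ hs ht, ← e, hD]
  unfold powerExpr Lentry coef coordN coordB coordA
  generalize (arPoly β).eval x⁻¹ = m at *
  generalize (arPoly β).eval y⁻¹ = l at *
  have hyx : y - x ≠ 0 := sub_ne_zero.2 hxy.symm
  have hxy' : x - y ≠ 0 := sub_ne_zero.2 hxy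
  have k1 : x ^ 2 - 1 ≠ 0 := by
    intro h; apply h1; field_simp; rw [h, mul_zero]
  have k2 : y ^ 2 - 1 ≠ 0 := by
    intro h; apply h2; field_simp; rw [h, mul_zero]
  have k3 : x * y - 1 ≠ 0 := by
    intro h; apply h3; field_simp; rw [h, mul_zero]
  have k1' : x * x - 1 ≠ 0 := by rwa [← sq]
  have k2' : y * y - 1 ≠ 0 := by rwa [← sq]
  have key : (x * x - 1) * (y * y - 1) * (x * y - 1) ^ 2 ≠ 0 := by positivity
  -- A Cauchy determinant: `(x y - 1)² - (x² - 1)(y² - 1) = (x - y)²`, which cancels the powers of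
  -- `x - y` coming from the coefficients.
  have hΔ : (x - y) ^ 2 * (1 / (x * (x - y)) * (1 / (x * (x - y))) * m * m / (x * x - 1) *
      (1 / (y * (y - x)) * (1 / (y * (y - x))) * l * l / (y * y - 1)) -
      (1 / (x * (x - y)) * (1 / (y * (y - x))) * m * l / (x * y - 1)) ^ 2) =
      m ^ 2 * l ^ 2 / (x ^ 2 * y ^ 2 * ((x * x - 1) * (y * y - 1) * (x * y - 1) ^ 2)) := by
    rw [← neg_sub x y]
    field_simp
    ring
  simp only []
  rw [hΔ, ← neg_sub x y]
  field_simp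
  ring

variable (β) in
theorem powerExprRepeated_eq {y : ℂ} (hy : 1 < ‖y‖) (hLy : (arPoly β).eval y⁻¹ ≠ 0) :
    powerExprRepeated β y = coordN ((arPoly β).eval y⁻¹) (divDiff β y⁻¹ y⁻¹) y⁻¹ y⁻¹ /
      coordDet ((arPoly β).eval y⁻¹) (divDiff β y⁻¹ y⁻¹) y⁻¹ y⁻¹ := by
  have hy0 : y ≠ 0 := by rintro rfl; norm_num at hy
  have ht : ‖y⁻¹‖ < 1 := by rw [norm_inv]; exact inv_lt_one_of_one_lt₀ hy
  have h2 := one_sub_sq_ne_zero ht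
  rw [coordDet_eq _ _ ht ht, divDiff_self]
  unfold powerExprRepeated coordN coordB coordA
  generalize (arPoly β).eval y⁻¹ = l at *
  have k2 : y ^ 2 - 1 ≠ 0 := by
    intro h; apply h2; field_simp; rw [h, mul_zero]
  simp only []
  rw [← sq]
  field_simp
  ring

end ClosedForm

/-! ### The limit of the Lyapunov iteration -/

section Lyapunov

open Matrix

/-- The inverse of the companion matrix of the recursion `V (n + 2) = a V (n + 1) + b V n`. -/
noncomputable def invCompanion (a b : ℝ) : Matrix (Fin 2) (Fin 2) ℝ := !![-a / b, 1; 1 / b, 0]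

/-- The coefficients of the whitened message with respect to two successive values of `V`. -/
noncomputable def whiteVec {p : ℕ} (β : Fin p → ℂ) (a b : ℝ) : Fin 2 → ℝ :=
  ∑ k ∈ Finset.range (p + 1), ((arPoly β).coeff k).re • ((invCompanion a b ^ k) *ᵥ ![1, 0])

/-- One step of the Lyapunov iteration. -/
def lyapStep {R : Type*} [CommRing R] (C : Matrix (Fin 2) (Fin 2) R) (u : Fin 2 → R)
    (N : Matrix (Fin 2) (Fin 2) R) : Matrix (Fin 2) (Fin 2) R :=
  C * (N + vecMulVec u u) * Cᵀ

theorem lyapStep_sub {R : Type*} [CommRing R] (C : Matrix (Fin 2) (Fin 2) R) (u : Fin 2 → R)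
    (N N' : Matrix (Fin 2) (Fin 2) R) :
    lyapStep C u N - lyapStep C u N' = C * (N - N') * Cᵀ := by
  simp only [lyapStep]
  noncomm_ring

theorem lyapStep_map (C : Matrix (Fin 2) (Fin 2) ℝ) (u : Fin 2 → ℝ)
    (N : Matrix (Fin 2) (Fin 2) ℝ) :
    (lyapStep C u N).map Complex.ofReal =
      lyapStep (C.map Complex.ofReal) (fun i => (u i : ℂ)) (N.map Complex.ofReal) := by
  ext i j
  simp [lyapStep, Matrix.mul_apply, vecMulVec_apply, Fin.sum_univ_two]

theorem lyapStep_posSemidef (C : Matrix (Fin 2) (Fin 2) ℝ) (u : Fin 2 → ℝ)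
    {N : Matrix (Fin 2) (Fin 2) ℝ} (hN : N.PosSemidef) : (lyapStep C u N).PosSemidef := by
  have := (hN.add (posSemidef_vecMulVec_self_star u)).mul_mul_conjTranspose_same C
  simpa [lyapStep] using this

/-- Newton interpolation of `X ^ k` at the eigenvalues: `C ^ k = t ^ k + geom k s t • (C - t)`. No
diagonalisation is used, so `s = t` is allowed. -/
theorem pow_eq_geom {s t : ℂ} (k : ℕ) :
    (!![s + t, 1; -(s * t), 0] : Matrix (Fin 2) (Fin 2) ℂ) ^ k =
      !![t ^ k + geom k s t * s, geom k s t; -(s * t) * geom k s t, t ^ k - t * geom k s t] := by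
  induction k with
  | zero => simp [geom, Matrix.one_fin_two]
  | succ k ih =>
    rw [pow_succ, ih, geom_succ]
    ext i j
    fin_cases i <;> fin_cases j <;> simp [Matrix.mul_apply, Fin.sum_univ_two] <;> ring

theorem tendsto_pow_zero {s t : ℂ} (hs : ‖s‖ < 1) (ht : ‖t‖ < 1) :
    Tendsto (fun k => (!![s + t, 1; -(s * t), 0] : Matrix (Fin 2) (Fin 2) ℂ) ^ k) atTop
      (𝓝 0) := by
  have hg := tendsto_geom hs ht
  have hp := tendsto_pow_atTop_nhds_zero_of_norm_lt_one ht
  simp only [pow_eq_geom]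
  refine tendsto_pi_nhds.2 fun i => tendsto_pi_nhds.2 fun j => ?_
  fin_cases i <;> fin_cases j
  · simpa using hp.add (hg.mul_const s)
  · simpa using hg
  · simpa using (hg.const_mul (s * t)).neg
  · simpa using hp.sub (hg.const_mul t)

/-- The iteration is affine, so the distance to a fixed point is just conjugated by `C ^ k`. Only an
eventual recursion is needed, because the starting matrix is forgotten. -/
theorem tendsto_of_lyapStep {C : Matrix (Fin 2) (Fin 2) ℂ} (u : Fin 2 → ℂ)
    (hC : Tendsto (fun k => C ^ k) atTop (𝓝 0)) {N : Matrix (Fin 2) (Fin 2) ℂ}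
    (hN : lyapStep C u N = N) {M : ℕ → Matrix (Fin 2) (Fin 2) ℂ} {n₀ : ℕ}
    (hM : ∀ n ≥ n₀, M (n + 1) = lyapStep C u (M n)) : Tendsto M atTop (𝓝 N) := by
  rw [← tendsto_add_atTop_iff_nat n₀]
  have h : ∀ k, M (k + n₀) = C ^ k * (M n₀ - N) * (C ^ k)ᵀ + N := by
    intro k
    induction k with
    | zero => simp
    | succ k ih =>
      have h' := lyapStep_sub C u (M (k + n₀)) N
      rw [hN, ← hM _ (by omega), sub_eq_iff_eq_add] at h'
      rw [show k + 1 + n₀ = (k + n₀) + 1 by ring, h', ih, add_sub_cancel_right, pow_succ',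
        Matrix.transpose_mul]
      noncomm_ring
  simp only [h]
  have hT : Tendsto (fun k => (C ^ k)ᵀ) atTop (𝓝 (0ᵀ)) :=
    (Continuous.matrix_transpose continuous_id).continuousAt.tendsto.comp hC
  have := ((hC.mul_const (M n₀ - N)).mul hT).add_const N
  simpa using this

/-- The fixed point of the Lyapunov iteration. -/
noncomputable def lyapSol (ℓ D s t : ℂ) : Matrix (Fin 2) (Fin 2) ℂ :=
  let α := t ^ 2 * coordA ℓ t
  let β := coordB ℓ D s t - ℓ * D
  let δ := coordN ℓ D s t
  !![α + 2 * β * s + δ * s ^ 2, -(s * t * β) - s ^ 2 * t * δ;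
    -(s * t * β) - s ^ 2 * t * δ, s ^ 2 * t ^ 2 * δ]

theorem lyapSol_det (ℓ D s t : ℂ) :
    (lyapSol ℓ D s t).det = s ^ 2 * t ^ 2 * coordDet ℓ D s t := by
  simp only [lyapSol, coordDet, Matrix.det_fin_two_of]
  ring

/-- In the basis `e = (1, 0)`, `w = (s, -s t)` one has `C e = t e + w` and `C w = s w`, and the
vector is `ℓ e + D w`. The equation becomes triangular: its three scalar equations are solved
successively by `coordA`, `coordB` and `coordN`. -/
theorem lyapStep_lyapSol (ℓ D : ℂ) {s t : ℂ} (hs : ‖s‖ < 1) (ht : ‖t‖ < 1) :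
    lyapStep !![s + t, 1; -(s * t), 0] ![ℓ + D * s, -(s * t * D)] (lyapSol ℓ D s t) =
      lyapSol ℓ D s t := by
  have hA : coordA ℓ t * (1 - t ^ 2) = ℓ ^ 2 := div_mul_cancel₀ _ (one_sub_sq_ne_zero ht)
  have hB : coordB ℓ D s t * (1 - s * t) = t * coordA ℓ t + ℓ * D :=
    div_mul_cancel₀ _ (one_sub_mul_ne_zero hs ht)
  have hN : coordN ℓ D s t * (1 - s ^ 2) = coordA ℓ t + 2 * s * coordB ℓ D s t + s ^ 2 * D ^ 2 :=
    div_mul_cancel₀ _ (one_sub_sq_ne_zero hs)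
  simp only [lyapSol, lyapStep]
  generalize coordA ℓ t = A at *
  generalize coordB ℓ D s t = B at *
  generalize coordN ℓ D s t = n at *
  ext i j
  fin_cases i <;> fin_cases j <;>
    simp only [Matrix.mul_apply, Fin.sum_univ_two, Matrix.add_apply, vecMulVec_apply,
      transpose_apply] <;> simp
  · linear_combination (-(s + t) ^ 2) * hA - 2 * s * hB - s ^ 2 * hN
  · linear_combination s * t * (s + t) * hA + s * t * hB + s ^ 2 * t * hN
  · linear_combination s * t * (s + t) * hA + s * t * hB + s ^ 2 * t * hN
  · linear_combination (-s ^ 2 * t ^ 2) * hA + (-s ^ 2 * t ^ 2) * hN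

theorem AreCharRoots.add_eq {a b : ℝ} {x y : ℂ} (h : AreCharRoots a b x y) : x + y = a := by
  have h0 := h 0
  have h1 := h 1
  linear_combination h1 - h0

theorem AreCharRoots.mul_eq {a b : ℝ} {x y : ℂ} (h : AreCharRoots a b x y) : x * y = -b := by
  linear_combination -h 0

theorem areCharRoots_of {a b : ℝ} {x y : ℂ} (h : x + y = a) (h' : x * y = -b) :
    AreCharRoots a b x y := fun z => by
  linear_combination z * h - h'

theorem ne_zero_of_one_lt_norm {x : ℂ} (h : 1 < ‖x‖) : x ≠ 0 := by
  rintro rfl; norm_num at h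

theorem norm_inv_lt_one {x : ℂ} (h : 1 < ‖x‖) : ‖x⁻¹‖ < 1 := by
  rw [norm_inv]; exact inv_lt_one_of_one_lt₀ h

theorem AreCharRoots.ne_zero {a b : ℝ} {x y : ℂ} (h : AreCharRoots a b x y) (hx : 1 < ‖x‖)
    (hy : 1 < ‖y‖) : b ≠ 0 := by
  rintro rfl
  have := h.mul_eq
  simp [ne_zero_of_one_lt_norm hx, ne_zero_of_one_lt_norm hy] at this

theorem AreCharRoots.invCompanion_map {a b : ℝ} {x y : ℂ} (h : AreCharRoots a b x y)
    (hx : 1 < ‖x‖) (hy : 1 < ‖y‖) :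
    (invCompanion a b).map Complex.ofReal = !![x⁻¹ + y⁻¹, 1; -(x⁻¹ * y⁻¹), 0] := by
  have hb : (b : ℂ) = -(x * y) := by rw [h.mul_eq]; ring
  have hx0 := ne_zero_of_one_lt_norm hx
  have hy0 := ne_zero_of_one_lt_norm hy
  ext i j
  fin_cases i <;> fin_cases j <;> simp [invCompanion, hb, ← h.add_eq]
  · field_simp
    ring
  · ring

/-- The vector is `L_Z(C) e` with `e = (1, 0)`, evaluated by the Newton form `L_Z(C) = L_Z(t) + D (C
- t)`. -/
theorem AreCharRoots.whiteVec_eq {p : ℕ} {β : Fin p → ℂ} (hβ : IsARParam β)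
    {a b : ℝ} {x y : ℂ} (h : AreCharRoots a b x y) (hx : 1 < ‖x‖) (hy : 1 < ‖y‖) :
    (fun i => (whiteVec β a b i : ℂ)) =
      ![(arPoly β).eval y⁻¹ + divDiff β x⁻¹ y⁻¹ * x⁻¹, -(x⁻¹ * y⁻¹ * divDiff β x⁻¹ y⁻¹)] := by
  have key : ∀ k i, ((((invCompanion a b ^ k) *ᵥ ![1, 0]) i : ℝ) : ℂ) =
      ((!![x⁻¹ + y⁻¹, 1; -(x⁻¹ * y⁻¹), 0] : Matrix (Fin 2) (Fin 2) ℂ) ^ k) i 0 := by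
    intro k i
    rw [← h.invCompanion_map hx hy]
    have : ((invCompanion a b).map Complex.ofReal) ^ k =
        (invCompanion a b ^ k).map Complex.ofReal :=
      (map_pow (Complex.ofRealHom.mapMatrix) (invCompanion a b) k).symm
    rw [this]
    simp [Matrix.mulVec, dotProduct, Fin.sum_univ_two]
  have h2 : ∀ i, (whiteVec β a b i : ℂ) = ∑ k ∈ Finset.range (p + 1), (arPoly β).coeff k *
      ((!![x⁻¹ + y⁻¹, 1; -(x⁻¹ * y⁻¹), 0] : Matrix (Fin 2) (Fin 2) ℂ) ^ k) i 0 := by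
    intro i
    simp only [whiteVec, Finset.sum_apply, Pi.smul_apply, smul_eq_mul, Complex.ofReal_sum,
      Complex.ofReal_mul, key, ← hβ.coeff_eq]
  funext i
  rw [h2]
  simp only [pow_eq_geom]
  fin_cases i
  · simp [mul_add, Finset.sum_add_distrib, eval_arPoly, divDiff, Finset.sum_mul, mul_assoc]
  · simp [divDiff, Finset.mul_sum, mul_comm, mul_left_comm, mul_assoc]

/-- The limit of the Lyapunov iteration is positive definite, and the power is a quotient of its
entries. -/
theorem exists_lyapLimit {p : ℕ} {β : Fin p → ℂ} (hβ : IsARParam β)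
    {a b : ℝ} {x y : ℂ} (h : AreCharRoots a b x y) (hx : 1 < ‖x‖) (hy : 1 < ‖y‖) :
    ∃ N : Matrix (Fin 2) (Fin 2) ℝ, 0 < N 1 1 ∧ 0 < N.det ∧
      N.map Complex.ofReal = lyapSol ((arPoly β).eval y⁻¹) (divDiff β x⁻¹ y⁻¹) x⁻¹ y⁻¹ ∧
      ∀ (M : ℕ → Matrix (Fin 2) (Fin 2) ℝ) (n₀ : ℕ),
        (∀ n ≥ n₀, M (n + 1) = lyapStep (invCompanion a b) (whiteVec β a b) (M n)) →
        Tendsto M atTop (𝓝 N) := by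
  have hs := norm_inv_lt_one hx
  have ht := norm_inv_lt_one hy
  set S := lyapSol ((arPoly β).eval y⁻¹) (divDiff β x⁻¹ y⁻¹) x⁻¹ y⁻¹ with hS
  have hlim : ∀ (M : ℕ → Matrix (Fin 2) (Fin 2) ℝ) (n₀ : ℕ),
      (∀ n ≥ n₀, M (n + 1) = lyapStep (invCompanion a b) (whiteVec β a b) (M n)) →
      Tendsto (fun n => (M n).map Complex.ofReal) atTop (𝓝 S) := by
    intro M n₀ hM
    refine tendsto_of_lyapStep (n₀ := n₀) _ (tendsto_pow_zero hs ht)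
      (lyapStep_lyapSol _ _ hs ht) fun n hn => ?_
    rw [hM n hn, lyapStep_map, h.invCompanion_map hx hy, h.whiteVec_eq hβ hx hy]
  have hre : ∀ (M : ℕ → Matrix (Fin 2) (Fin 2) ℝ) (n₀ : ℕ),
      (∀ n ≥ n₀, M (n + 1) = lyapStep (invCompanion a b) (whiteVec β a b) (M n)) →
      Tendsto M atTop (𝓝 (S.map Complex.re)) := by
    intro M n₀ hM
    refine tendsto_pi_nhds.2 fun i => tendsto_pi_nhds.2 fun j => ?_
    have := ((tendsto_pi_nhds.1 (tendsto_pi_nhds.1 (hlim M n₀ hM) i)) j)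
    simpa [Function.comp_def] using (Complex.continuous_re.tendsto _).comp this
  -- The iteration started at `0` consists of real positive semidefinite matrices. Its limit, the
  -- complex closed form, is therefore real and positive semidefinite; the nonzero determinant makes
  -- it definite.
  set M : ℕ → Matrix (Fin 2) (Fin 2) ℝ :=
    fun n => (lyapStep (invCompanion a b) (whiteVec β a b))^[n] 0 with hMdef
  have hM : ∀ n ≥ 0, M (n + 1) = lyapStep (invCompanion a b) (whiteVec β a b) (M n) :=
    fun n _ => Function.iterate_succ_apply' _ _ _
  have hpsd : ∀ n, (M n).PosSemidef := by
    intro n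
    induction n with
    | zero => exact Matrix.PosSemidef.zero
    | succ n ih => rw [hM n (Nat.zero_le _)]; exact lyapStep_posSemidef _ _ ih
  have hMl := hre M 0 hM
  have hmap : (S.map Complex.re).map Complex.ofReal = S := by
    refine tendsto_nhds_unique ?_ (hlim M 0 hM)
    have hc : Continuous fun A : Matrix (Fin 2) (Fin 2) ℝ => A.map Complex.ofReal :=
      continuous_id.matrix_map Complex.continuous_ofReal
    exact (hc.tendsto _).comp hMl
  have hdet0 : 0 ≤ (S.map Complex.re).det := by
    have hc : Continuous fun A : Matrix (Fin 2) (Fin 2) ℝ => A.det := continuous_id.matrix_det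
    exact ge_of_tendsto' ((hc.tendsto _).comp hMl) fun n => (hpsd n).det_nonneg
  have h11 : ∀ i, 0 ≤ (S.map Complex.re) i i := fun i =>
    ge_of_tendsto' (tendsto_pi_nhds.1 (tendsto_pi_nhds.1 hMl i) i) fun n => (hpsd n).diag_nonneg
  have hdet : (((S.map Complex.re).det : ℝ) : ℂ) ≠ 0 := by
    have : (((S.map Complex.re).det : ℝ) : ℂ) = S.det := by
      conv_rhs => rw [← hmap]
      exact Complex.ofRealHom.map_det _
    rw [this, hS, lyapSol_det, coordDet_eq _ _ hs ht, ← eval_eq_add_divDiff]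
    have e1 := hβ.eval_ne_zero hs.le
    have e2 := hβ.eval_ne_zero ht.le
    have e3 := one_sub_sq_ne_zero hs
    have e4 := one_sub_sq_ne_zero ht
    have e5 := one_sub_mul_ne_zero hs ht
    have e6 := inv_ne_zero (ne_zero_of_one_lt_norm hx)
    have e7 := inv_ne_zero (ne_zero_of_one_lt_norm hy)
    positivity
  have hdetpos : 0 < (S.map Complex.re).det :=
    lt_of_le_of_ne hdet0 fun h => hdet (by rw [← h]; simp)
  refine ⟨S.map Complex.re, ?_, hdetpos, hmap, hre⟩
  refine lt_of_le_of_ne (h11 1) fun h0 => ?_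
  have hsym : S 1 0 = S 0 1 := by simp [hS, lyapSol]
  rw [Matrix.det_fin_two, ← h0] at hdetpos
  simp only [Matrix.map_apply, hsym] at hdetpos
  nlinarith [mul_self_nonneg (S 0 1).re]

end Lyapunov

/-! ### Properties of the power expression and existence of the maximum -/

section Maximum

variable {p : ℕ} {β : Fin p → ℂ}

/-- The numerator of the power expression as a function of the inverse roots. -/
noncomputable def powerNum {p : ℕ} (β : Fin p → ℂ) (x : ℂ × ℂ) : ℂ :=
  coordN ((arPoly β).eval x.2) (divDiff β x.1 x.2) x.1 x.2

/-- The denominator of the power expression as a function of the inverse roots. -/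
noncomputable def powerDen {p : ℕ} (β : Fin p → ℂ) (x : ℂ × ℂ) : ℂ :=
  coordDet ((arPoly β).eval x.2) (divDiff β x.1 x.2) x.1 x.2

theorem powerExpr_eq_div (hβ : IsARParam β) {x y : ℂ} (hx : 1 < ‖x‖) (hy : 1 < ‖y‖)
    (hxy : x ≠ y) : powerExpr β x y = powerNum β (x⁻¹, y⁻¹) / powerDen β (x⁻¹, y⁻¹) :=
  powerExpr_eq β hx hy hxy (hβ.eval_ne_zero (norm_inv_lt_one hx).le)
    (hβ.eval_ne_zero (norm_inv_lt_one hy).le)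

theorem powerExprRepeated_eq_div (hβ : IsARParam β) {y : ℂ} (hy : 1 < ‖y‖) :
    powerExprRepeated β y = powerNum β (y⁻¹, y⁻¹) / powerDen β (y⁻¹, y⁻¹) :=
  powerExprRepeated_eq β hy (hβ.eval_ne_zero (norm_inv_lt_one hy).le)

theorem powerDen_ne_zero (hβ : IsARParam β) {x : ℂ × ℂ} (h1 : ‖x.1‖ < 1) (h2 : ‖x.2‖ < 1)
    (h1' : x.1 ≠ 0) (h2' : x.2 ≠ 0) : powerDen β x ≠ 0 := by
  rw [powerDen, coordDet_eq _ _ h1 h2, ← eval_eq_add_divDiff]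
  have e1 := hβ.eval_ne_zero h1.le
  have e2 := hβ.eval_ne_zero h2.le
  have e3 := one_sub_sq_ne_zero h1
  have e4 := one_sub_sq_ne_zero h2
  have e5 := one_sub_mul_ne_zero h1 h2
  positivity

theorem continuousOn_powerNum_powerDen :
    ContinuousOn (powerNum β) {x | ‖x.1‖ < 1 ∧ ‖x.2‖ < 1} ∧
      ContinuousOn (powerDen β) {x | ‖x.1‖ < 1 ∧ ‖x.2‖ < 1} := by
  have hL : ContinuousOn (fun x : ℂ × ℂ => (arPoly β).eval x.2) {x | ‖x.1‖ < 1 ∧ ‖x.2‖ < 1} :=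
    ((arPoly β).continuous.comp continuous_snd).continuousOn
  have hD : ContinuousOn (fun x : ℂ × ℂ => divDiff β x.1 x.2) {x | ‖x.1‖ < 1 ∧ ‖x.2‖ < 1} :=
    (continuous_divDiff β).continuousOn
  have hA : ContinuousOn (fun x : ℂ × ℂ => coordA ((arPoly β).eval x.2) x.2)
      {x | ‖x.1‖ < 1 ∧ ‖x.2‖ < 1} := by
    unfold coordA
    exact (hL.pow 2).div (by fun_prop) fun x hx => one_sub_sq_ne_zero hx.2
  have hB : ContinuousOn (fun x : ℂ × ℂ => coordB ((arPoly β).eval x.2) (divDiff β x.1 x.2) x.1 x.2)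
      {x | ‖x.1‖ < 1 ∧ ‖x.2‖ < 1} := by
    unfold coordB
    exact ((continuousOn_snd.mul hA).add (hL.mul hD)).div (by fun_prop)
      fun x hx => one_sub_mul_ne_zero hx.1 hx.2
  have hN : ContinuousOn (powerNum β) {x | ‖x.1‖ < 1 ∧ ‖x.2‖ < 1} := by
    unfold powerNum coordN
    exact ((hA.add ((continuousOn_const.mul continuousOn_fst).mul hB)).add
      ((continuousOn_fst.pow 2).mul (hD.pow 2))).div (by fun_prop)
      fun x hx => one_sub_sq_ne_zero hx.1
  refine ⟨hN, ?_⟩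
  unfold powerDen coordDet
  exact (((continuousOn_snd.pow 2).mul hA).mul hN).sub ((hB.sub (hL.mul hD)).pow 2)

/-- Passing from the triangular basis to the standard one multiplies both the last entry and the
determinant by `(s t)² = b⁻²`, so their quotient is unchanged. Realness of the power expression
comes from that of `N`. -/
theorem AreCharRoots.power_eq_div (hβ : IsARParam β) {a b : ℝ} {x y : ℂ}
    (h : AreCharRoots a b x y) (hx : 1 < ‖x‖) (hy : 1 < ‖y‖) {N : Matrix (Fin 2) (Fin 2) ℝ}
    (hN : N.map Complex.ofReal = lyapSol ((arPoly β).eval y⁻¹) (divDiff β x⁻¹ y⁻¹) x⁻¹ y⁻¹)  :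
    power β x y = N 1 1 / N.det ∧
      powerNum β (x⁻¹, y⁻¹) = ((b ^ 2 * N 1 1 : ℝ) : ℂ) ∧
      powerDen β (x⁻¹, y⁻¹) = ((b ^ 2 * N.det : ℝ) : ℂ) := by
  have hx0 := ne_zero_of_one_lt_norm hx
  have hy0 := ne_zero_of_one_lt_norm hy
  have hb : (b : ℂ) = -(x * y) := by rw [h.mul_eq]; ring
  have hb0 := h.ne_zero hx hy
  have h1 : powerNum β (x⁻¹, y⁻¹) = ((b ^ 2 * N 1 1 : ℝ) : ℂ) := by
    have : ((N 1 1 : ℝ) : ℂ) = (N.map Complex.ofReal) 1 1 := rfl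
    push_cast
    rw [this, hN, hb]
    have h11 : ∀ ℓ D s t, lyapSol ℓ D s t 1 1 = s ^ 2 * t ^ 2 * coordN ℓ D s t := fun _ _ _ _ => rfl
    rw [h11, powerNum]
    field_simp
  have h2 : powerDen β (x⁻¹, y⁻¹) = ((b ^ 2 * N.det : ℝ) : ℂ) := by
    have : ((N.det : ℝ) : ℂ) = (N.map Complex.ofReal).det := Complex.ofRealHom.map_det _
    push_cast
    rw [this, hN, lyapSol_det, hb, powerDen]
    field_simp
  refine ⟨?_, h1, h2⟩
  have h3 : ((b ^ 2 * N 1 1 : ℝ) : ℂ) / ((b ^ 2 * N.det : ℝ) : ℂ) = ((N 1 1 / N.det : ℝ) : ℂ) := by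
    rw [← Complex.ofReal_div, mul_div_mul_left _ _ (pow_ne_zero 2 hb0)]
  unfold power
  split_ifs with hxy
  · subst hxy
    rw [powerExprRepeated_eq_div hβ hx, h1, h2, h3, Complex.ofReal_re]
  · rw [powerExpr_eq_div hβ hx hy hxy, h1, h2, h3, Complex.ofReal_re]

theorem AreCharRoots.ofReal_power (hβ : IsARParam β) {a b : ℝ} {x y : ℂ}
    (h : AreCharRoots a b x y) (hx : 1 < ‖x‖) (hy : 1 < ‖y‖) :
    (power β x y : ℂ) = powerNum β (x⁻¹, y⁻¹) / powerDen β (x⁻¹, y⁻¹) := by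
  obtain ⟨N, -, -, hN, -⟩ := exists_lyapLimit hβ h hx hy
  obtain ⟨h1, h2, h3⟩ := h.power_eq_div hβ hx hy hN
  rw [h1, h2, h3, ← Complex.ofReal_div, mul_div_mul_left _ _ (pow_ne_zero 2 (h.ne_zero hx hy))]

/-- The constraint without division still makes sense when an inverse root is `0`, and so defines a
closed condition in the compactness argument. -/
theorem AreCharRoots.power_le_iff (hβ : IsARParam β) {a b : ℝ} {x y : ℂ}
    (h : AreCharRoots a b x y) (hx : 1 < ‖x‖) (hy : 1 < ‖y‖) (P : ℝ) :
    power β x y ≤ P ↔ (powerNum β (x⁻¹, y⁻¹)).re ≤ P * (powerDen β (x⁻¹, y⁻¹)).re := by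
  obtain ⟨N, -, hd, hN, -⟩ := exists_lyapLimit hβ h hx hy
  obtain ⟨h1, h2, h3⟩ := h.power_eq_div hβ hx hy hN
  have hb : 0 < b ^ 2 := by have := h.ne_zero hx hy; positivity
  rw [h1, h2, h3, Complex.ofReal_re, Complex.ofReal_re, div_le_iff₀ hd, mul_left_comm,
    mul_le_mul_iff_right₀ hb]

theorem powerExpr_eq_power (hβ : IsARParam β) {a b : ℝ} {x y : ℂ}
    (h : AreCharRoots a b x y) (hx : 1 < ‖x‖) (hy : 1 < ‖y‖) (hxy : x ≠ y) :
    powerExpr β x y = (power β x y : ℂ) := by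
  rw [h.ofReal_power hβ hx hy, powerExpr_eq_div hβ hx hy hxy]

theorem areCharRoots_self (γ : ℝ) : AreCharRoots (2 * γ) (-γ ^ 2) (γ : ℂ) γ :=
  areCharRoots_of (by push_cast; ring) (by push_cast; ring)

theorem tendsto_powerExpr (hβ : IsARParam β) {γ : ℝ} (hγ : 1 < |γ|) :
    Tendsto (fun z : ℂ => powerExpr β z (γ : ℂ)) (𝓝[≠] (γ : ℂ)) (𝓝 (power β (γ : ℂ) γ : ℂ)) := by
  have hγ' : 1 < ‖(γ : ℂ)‖ := by simpa using hγ
  have hγ0 := ne_zero_of_one_lt_norm hγ'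
  have ht := norm_inv_lt_one hγ'
  rw [(areCharRoots_self γ).ofReal_power hβ hγ' hγ']
  have hopen : IsOpen {x : ℂ × ℂ | ‖x.1‖ < 1 ∧ ‖x.2‖ < 1} :=
    (isOpen_lt continuous_fst.norm continuous_const).and
      (isOpen_lt continuous_snd.norm continuous_const)
  have hmem : {x : ℂ × ℂ | ‖x.1‖ < 1 ∧ ‖x.2‖ < 1} ∈ 𝓝 ((γ : ℂ)⁻¹, (γ : ℂ)⁻¹) :=
    hopen.mem_nhds ⟨ht, ht⟩
  have hc : ContinuousAt (fun z : ℂ => (z⁻¹, (γ : ℂ)⁻¹)) (γ : ℂ) := by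
    exact (continuousAt_inv₀ hγ0).prodMk continuousAt_const
  have hq : ContinuousAt (fun x => powerNum β x / powerDen β x) ((γ : ℂ)⁻¹, (γ : ℂ)⁻¹) :=
    (continuousOn_powerNum_powerDen.1.continuousAt hmem).div
      (continuousOn_powerNum_powerDen.2.continuousAt hmem)
      (powerDen_ne_zero hβ ht ht (inv_ne_zero hγ0) (inv_ne_zero hγ0))
  have hcomp : ContinuousAt (fun z : ℂ => powerNum β (z⁻¹, (γ : ℂ)⁻¹) / powerDen β (z⁻¹, (γ : ℂ)⁻¹))
      (γ : ℂ) := ContinuousAt.comp' (f := fun z : ℂ => (z⁻¹, (γ : ℂ)⁻¹)) hq hc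
  refine (hcomp.tendsto.mono_left nhdsWithin_le_nhds).congr' ?_
  have hz : ∀ᶠ z : ℂ in 𝓝[≠] (γ : ℂ), 1 < ‖z‖ :=
    nhdsWithin_le_nhds ((isOpen_lt continuous_const continuous_norm).mem_nhds hγ')
  filter_upwards [hz, self_mem_nhdsWithin] with z hz hne
  exact (powerExpr_eq_div hβ hz hγ' hne).symm

/-- A repeated real root decreasing to `1` works: the power expression is continuous there and
vanishes at `1`. -/
theorem exists_feasible (hβ : IsARParam β) {P : ℝ} (hP : 0 < P) :
    ∃ γ : ℝ, 1 < γ ∧ Feasible β P (2 * γ) (-γ ^ 2) (γ : ℂ) γ := by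
  have hL1 : (arPoly β).eval ((1 : ℂ)⁻¹) ≠ 0 := hβ.eval_ne_zero (by simp)
  have hc : ContinuousAt (fun z : ℂ => powerExprRepeated β z) 1 := by
    have h1 : ContinuousAt (fun z : ℂ => (arPoly β).eval z⁻¹) 1 :=
      ContinuousAt.comp' (f := fun z : ℂ => z⁻¹) (arPoly β).continuous.continuousAt
        (continuousAt_inv₀ one_ne_zero)
    have h2 : ContinuousAt (fun z : ℂ => (arPoly β).derivative.eval z⁻¹) 1 :=
      ContinuousAt.comp' (f := fun z : ℂ => z⁻¹) (arPoly β).derivative.continuous.continuousAt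
        (continuousAt_inv₀ one_ne_zero)
    have hid : ContinuousAt (fun z : ℂ => z) 1 := continuousAt_id
    unfold powerExprRepeated
    refine ((ContinuousAt.div ?_ ?_ ?_).add (ContinuousAt.mul (ContinuousAt.div ?_ ?_ ?_)
      (ContinuousAt.div ?_ ?_ ?_))).add (ContinuousAt.div ?_ ?_ ?_)
    any_goals fun_prop
    all_goals first | exact one_ne_zero | exact pow_ne_zero _ hL1 | simp
    all_goals simpa using hL1
  have h0 : powerExprRepeated β 1 = 0 := by simp [powerExprRepeated]
  have hre : ContinuousAt (fun x : ℝ => (powerExprRepeated β (x : ℂ)).re) 1 :=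
    Complex.continuous_re.continuousAt.comp
      (ContinuousAt.comp (g := fun z : ℂ => powerExprRepeated β z) (by simpa using hc)
        Complex.continuous_ofReal.continuousAt)
  have hev : ∀ᶠ x : ℝ in 𝓝[>] 1, (powerExprRepeated β (x : ℂ)).re < P := by
    have : ∀ᶠ x : ℝ in 𝓝 1, (powerExprRepeated β (x : ℂ)).re < P :=
      hre.eventually_lt_const (by simpa [h0] using hP)
    exact nhdsWithin_le_nhds this
  obtain ⟨γ, h1, h2⟩ := (hev.and self_mem_nhdsWithin).exists
  have h2 : 1 < γ := h2
  have hn : 1 < ‖(γ : ℂ)‖ := by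
    rw [Complex.norm_real, Real.norm_eq_abs]; exact h2.trans_le (le_abs_self _)
  refine ⟨γ, h2, ?_, areCharRoots_self γ, hn, hn, ?_⟩
  · have : γ ≠ 0 := by linarith
    simpa using this
  · simpa [power] using h1.le

/-- An inverse root `0` stands for a root escaping to infinity; the inequality `num ≤ P * den` then
fails, whatever `P`. The other inverse root is real because the sum of the two is. -/
theorem powerNum_zero_left (hβ : IsARParam β) {t : ℝ} (ht : ‖(t : ℂ)‖ < 1) :
    0 < (powerNum β (0, t)).re ∧ powerDen β (0, t) = 0 := by
  constructor
  · have h1 : (powerNum β (0, t)) =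
        ((((arPoly β).eval (t : ℂ)).re ^ 2 / (1 - t ^ 2) : ℝ) : ℂ) := by
      simp only [powerNum, coordN, coordA]
      push_cast
      rw [← hβ.eval_ofReal t]
      simp
    have h2 : ((arPoly β).eval (t : ℂ)).re ≠ 0 := fun h0 =>
      hβ.eval_ne_zero ht.le (by rw [hβ.eval_ofReal, h0, Complex.ofReal_zero])
    rw [h1, Complex.ofReal_re]
    have : t ^ 2 < 1 := by
      rw [sq_lt_one_iff_abs_lt_one]; simpa using ht
    have : 0 < 1 - t ^ 2 := by linarith
    positivity
  · rw [powerDen, coordDet_eq _ _ (by simp) ht]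
    simp

theorem powerNum_zero_right (hβ : IsARParam β) {s : ℝ} (hs : ‖(s : ℂ)‖ < 1) :
    0 < (powerNum β (s, 0)).re ∧ powerDen β (s, 0) = 0 := by
  constructor
  · have h1 : (powerNum β (s, 0)) =
        ((((arPoly β).eval (s : ℂ)).re ^ 2 / (1 - s ^ 2) : ℝ) : ℂ) := by
      have e := eval_eq_add_divDiff β s 0
      simp only [powerNum, coordN, coordB, coordA]
      push_cast
      rw [← hβ.eval_ofReal s, e]
      simp
      ring
    have h2 : ((arPoly β).eval (s : ℂ)).re ≠ 0 := fun h0 =>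
      hβ.eval_ne_zero hs.le (by rw [hβ.eval_ofReal, h0, Complex.ofReal_zero])
    rw [h1, Complex.ofReal_re]
    have : s ^ 2 < 1 := by
      rw [sq_lt_one_iff_abs_lt_one]; simpa using hs
    have : 0 < 1 - s ^ 2 := by linarith
    positivity
  · rw [powerDen, coordDet_eq _ _ hs (by simp)]
    simp

theorem rate_eq {x y : ℂ} (hx : 1 < ‖x‖) (hy : 1 < ‖y‖) :
    rate x y = -(2 * Real.log (max ‖x⁻¹‖ ‖y⁻¹‖)) := by
  have hx0 : 0 < ‖x‖ := by linarith
  have hy0 : 0 < ‖y‖ := by linarith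
  have : max ‖x⁻¹‖ ‖y⁻¹‖ = (min ‖x‖ ‖y‖)⁻¹ := by
    rw [norm_inv, norm_inv]
    rcases le_total ‖x‖ ‖y‖ with h | h
    · rw [min_eq_left h, max_eq_left (inv_anti₀ hx0 h)]
    · rw [min_eq_right h, max_eq_right (inv_anti₀ hy0 h)]
  rw [this, Real.log_inv, rate]
  ring

/-- Maximising the rate means minimising the larger modulus of the inverse roots. One feasible pair
confines the search to a closed bidisc of radius `r < 1`; real sum and product there encode a real
quadratic, and the constraint is closed. The minimiser has no zero coordinate, so it can be inverted
back. -/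
theorem exists_isGreatest (hβ : IsARParam β) {P : ℝ} (hP : 0 < P) :
    ∃ R : ℝ, IsGreatest (feasibleRates β P) R := by
  obtain ⟨γ, hγ1, hγ⟩ := exists_feasible hβ hP
  have hγn : 1 < ‖(γ : ℂ)‖ := hγ.2.2.1
  set r : ℝ := ‖(γ : ℂ)⁻¹‖ with hr
  have hr1 : r < 1 := norm_inv_lt_one hγn
  set K₀ : Set (ℂ × ℂ) := (Metric.closedBall 0 r ×ˢ Metric.closedBall 0 r) ∩
    {x | (x.1 + x.2).im = 0 ∧ (x.1 * x.2).im = 0} with hK₀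
  have hK₀c : IsCompact K₀ := by
    refine ((isCompact_closedBall _ _).prod (isCompact_closedBall _ _)).inter_right ?_
    exact (isClosed_eq (by fun_prop) continuous_const).inter
      (isClosed_eq (by fun_prop) continuous_const)
  have hsub : K₀ ⊆ {x | ‖x.1‖ < 1 ∧ ‖x.2‖ < 1} := by
    rintro ⟨s, t⟩ ⟨⟨h1, h2⟩, -⟩
    simp only [mem_closedBall_zero_iff] at h1 h2
    exact ⟨h1.trans_lt hr1, h2.trans_lt hr1⟩
  set K : Set (ℂ × ℂ) := {x ∈ K₀ | (powerNum β x).re ≤ P * (powerDen β x).re} with hK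
  have hKc : IsCompact K := by
    refine hK₀c.of_isClosed_subset ?_ (Set.sep_subset _ _)
    refine hK₀c.isClosed.isClosed_le ?_ ?_
    · exact Complex.continuous_re.comp_continuousOn (continuousOn_powerNum_powerDen.1.mono hsub)
    · exact continuousOn_const.mul
        (Complex.continuous_re.comp_continuousOn (continuousOn_powerNum_powerDen.2.mono hsub))
  have hmem : ∀ {a b : ℝ} {x y : ℂ}, Feasible β P a b x y → ‖x⁻¹‖ ≤ r → ‖y⁻¹‖ ≤ r →
      (x⁻¹, y⁻¹) ∈ K := by
    rintro a b x y ⟨hb, h, hx, hy, hp⟩ h1 h2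
    have hx0 := ne_zero_of_one_lt_norm hx
    have hy0 := ne_zero_of_one_lt_norm hy
    have hmul : x⁻¹ * y⁻¹ = ((-1 / b : ℝ) : ℂ) := by
      have : (b : ℂ) = -(x * y) := by rw [h.mul_eq]; ring
      push_cast
      rw [this]
      field_simp
    have hadd : x⁻¹ + y⁻¹ = ((-a / b : ℝ) : ℂ) := by
      have : (b : ℂ) = -(x * y) := by rw [h.mul_eq]; ring
      push_cast
      rw [this, ← h.add_eq]
      field_simp
      ring
    refine ⟨⟨⟨by simpa using h1, by simpa using h2⟩, ?_, ?_⟩, (h.power_le_iff hβ hx hy P).1 hp⟩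
    · simp only [hadd, Complex.ofReal_im]
    · simp only [hmul, Complex.ofReal_im]
  have hKne : K.Nonempty := ⟨_, hmem hγ le_rfl le_rfl⟩
  obtain ⟨⟨s, t⟩, hst, hmin⟩ := hKc.exists_isMinOn hKne
    (f := fun x : ℂ × ℂ => max ‖x.1‖ ‖x.2‖) (by fun_prop)
  obtain ⟨hs1, ht1⟩ := hsub hst.1
  obtain ⟨⟨⟨hsr, htr⟩, hadd, hmul⟩, hle⟩ := hst
  simp only [mem_closedBall_zero_iff] at hs1 ht1 hadd hmul hsr htr
  have hs0 : s ≠ 0 := by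
    rintro rfl
    have ht : t = (t.re : ℂ) := Complex.ext rfl (by simpa using hadd)
    rw [ht] at ht1
    obtain ⟨h1, h2⟩ := powerNum_zero_left hβ ht1
    rw [ht, h2] at hle
    simp only [Complex.zero_re, mul_zero] at hle
    exact absurd h1 (not_lt.2 hle)
  have ht0 : t ≠ 0 := by
    rintro rfl
    have hs : s = (s.re : ℂ) := Complex.ext rfl (by simpa using hadd)
    rw [hs] at hs1
    obtain ⟨h1, h2⟩ := powerNum_zero_right hβ hs1
    rw [hs, h2] at hle
    simp only [Complex.zero_re, mul_zero] at hle
    exact absurd h1 (not_lt.2 hle)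
  have one_lt : ∀ {z : ℂ}, z ≠ 0 → ‖z‖ < 1 → 1 < ‖z⁻¹‖ := by
    intro z h0 h1
    rw [norm_inv]
    exact (one_lt_inv₀ (norm_pos_iff.2 h0)).2 h1
  have hx1 := one_lt hs0 hs1
  have hy1 := one_lt ht0 ht1
  have hmulr : s * t = ((s * t).re : ℂ) := Complex.ext rfl (by simpa using hmul)
  have haddr : s + t = ((s + t).re : ℂ) := Complex.ext rfl (by simpa using hadd)
  have hroots : AreCharRoots ((s + t).re / (s * t).re) (-1 / (s * t).re) s⁻¹ t⁻¹ := by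
    refine areCharRoots_of ?_ ?_
    · push_cast
      rw [← hmulr, ← haddr]
      field_simp
      ring
    · push_cast
      rw [← hmulr]
      field_simp
  have hfeas : Feasible β P ((s + t).re / (s * t).re) (-1 / (s * t).re) s⁻¹ t⁻¹ := by
    refine ⟨hroots.ne_zero hx1 hy1, hroots, hx1, hy1, (hroots.power_le_iff hβ hx1 hy1 P).2 ?_⟩
    simpa only [inv_inv] using hle
  refine ⟨rate s⁻¹ t⁻¹, ⟨_, _, _, _, hfeas, rfl⟩, ?_⟩
  rintro R ⟨a, b, x, y, hxy, rfl⟩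
  have hx := hxy.2.2.1
  have hy := hxy.2.2.2.1
  rw [rate_eq hx hy, rate_eq hx1 hy1, inv_inv, inv_inv]
  have hpos : 0 < max ‖x⁻¹‖ ‖y⁻¹‖ :=
    lt_max_of_lt_left (norm_pos_iff.2 (inv_ne_zero (ne_zero_of_one_lt_norm hx)))
  have hpos' : 0 < max ‖s‖ ‖t‖ := lt_max_of_lt_left (norm_pos_iff.2 hs0)
  suffices h : max ‖s‖ ‖t‖ ≤ max ‖x⁻¹‖ ‖y⁻¹‖ by
    have := Real.log_le_log hpos' h
    linarith
  -- A strictly better pair would have inverse roots of modulus at most `r`, hence would lie in `K`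
  -- and contradict minimality.
  by_contra! hlt
  have hr' : max ‖x⁻¹‖ ‖y⁻¹‖ ≤ r := hlt.le.trans (max_le hsr htr)
  have := hmin (hmem hxy ((le_max_left _ _).trans hr') ((le_max_right _ _).trans hr'))
  exact absurd hlt (not_lt.2 this)

end Maximum

/-! ### Recursive least squares in an inner product space -/

section LeastSquares

open scoped InnerProductSpace

variable {H : Type*} [NormedAddCommGroup H] [InnerProductSpace ℝ H]

/-- The error of the least squares estimate by the first `n` vectors of a sequence. -/
noncomputable def resid (y : ℕ → H) : ℕ → H →ₗ[ℝ] H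
  | 0 => LinearMap.id
  | n + 1 => resid y n - (LinearMap.toSpanSingleton ℝ H (resid y n (y n))) ∘ₗ
      ((‖resid y n (y n)‖ ^ 2)⁻¹ • ((innerₗ H (resid y n (y n))) ∘ₗ resid y n))

variable (y : ℕ → H)

theorem resid_succ (n : ℕ) (x : H) : resid y (n + 1) x = resid y n x -
    ((‖resid y n (y n)‖ ^ 2)⁻¹ * ⟪resid y n (y n), resid y n x⟫_ℝ) • resid y n (y n) := by
  simp [resid]

theorem sub_resid_mem (n : ℕ) (x : H) :
    x - resid y n x ∈ Submodule.span ℝ (y '' Set.Iio n) := by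
  induction n generalizing x with
  | zero => simp [resid]
  | succ n ih =>
    have hle : Submodule.span ℝ (y '' Set.Iio n) ≤ Submodule.span ℝ (y '' Set.Iio (n + 1)) :=
      Submodule.span_mono (Set.image_mono (Set.Iio_subset_Iio (Nat.le_succ n)))
    have hy : resid y n (y n) ∈ Submodule.span ℝ (y '' Set.Iio (n + 1)) := by
      have h1 : y n ∈ Submodule.span ℝ (y '' Set.Iio (n + 1)) :=
        Submodule.subset_span ⟨n, Nat.lt_succ_self n, rfl⟩
      simpa using Submodule.sub_mem _ h1 (hle (ih (y n)))
    rw [resid_succ, sub_sub_eq_add_sub, add_sub_right_comm]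
    exact Submodule.add_mem _ (hle (ih x)) (Submodule.smul_mem _ _ hy)

theorem inner_of_mem_span {y : ℕ → H} {n : ℕ} {x k : H} (h : ∀ j < n, ⟪y j, x⟫_ℝ = 0)
    (hk : k ∈ Submodule.span ℝ (y '' Set.Iio n)) : ⟪k, x⟫_ℝ = 0 := by
  induction hk using Submodule.span_induction with
  | mem k hk => obtain ⟨j, hj, rfl⟩ := hk; exact h j hj
  | zero => simp
  | add a b _ _ ha hb => rw [inner_add_left, ha, hb, add_zero]
  | smul c a _ ha => rw [inner_smul_left, ha, mul_zero]

theorem inner_resid_of_lt {n j : ℕ} (hj : j < n) (x : H) : ⟪y j, resid y n x⟫_ℝ = 0 := by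
  induction n generalizing j x with
  | zero => omega
  | succ n ih =>
    have hn : ⟪y n, resid y n x⟫_ℝ = ⟪resid y n (y n), resid y n x⟫_ℝ := by
      have := inner_of_mem_span (fun j hj => ih hj x) (sub_resid_mem y n (y n))
      rwa [inner_sub_left, sub_eq_zero] at this
    have hnn : ⟪y n, resid y n (y n)⟫_ℝ = ‖resid y n (y n)‖ ^ 2 := by
      have := inner_of_mem_span (fun j hj => ih hj (y n)) (sub_resid_mem y n (y n))
      rwa [inner_sub_left, sub_eq_zero, real_inner_self_eq_norm_sq] at this
    rw [resid_succ, inner_sub_right, inner_smul_right]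
    rcases Nat.lt_succ_iff_lt_or_eq.1 hj with h | rfl
    · rw [ih h, ih h]; simp
    · rw [hn, hnn]
      -- An observation already determined by the earlier ones has residual `0`; the inverse norm is
      -- then `0` by convention and the update does nothing.
      by_cases h0 : resid y j (y j) = 0
      · simp [h0]
      · have : ‖resid y j (y j)‖ ^ 2 ≠ 0 := by simpa using h0
        field_simp
        ring

theorem inner_resid_of_mem {n : ℕ} {k : H} (hk : k ∈ Submodule.span ℝ (y '' Set.Iio n)) (x : H) :
    ⟪k, resid y n x⟫_ℝ = 0 :=
  inner_of_mem_span (fun _ hj => inner_resid_of_lt y hj x) hk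

theorem inner_resid_resid (n : ℕ) (x x' : H) :
    ⟪resid y n x, resid y n x'⟫_ℝ = ⟪x, resid y n x'⟫_ℝ := by
  have := inner_resid_of_mem y (sub_resid_mem y n x) x'
  rw [inner_sub_left, sub_eq_zero] at this
  exact this.symm

theorem resid_of_mem {n : ℕ} {k : H} (hk : k ∈ Submodule.span ℝ (y '' Set.Iio n)) :
    resid y n k = 0 := by
  rw [← inner_self_eq_zero (𝕜 := ℝ), inner_resid_resid, inner_resid_of_mem y hk]

theorem resid_of_inner_eq_zero {n : ℕ} {x : H} (h : ∀ j < n, ⟪y j, x⟫_ℝ = 0) :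
    resid y n x = x := by
  have h1 := inner_of_mem_span h (sub_resid_mem y n x)
  have h2 := inner_resid_of_mem y (sub_resid_mem y n x) x
  rw [← sub_eq_zero, ← neg_eq_zero, neg_sub, ← inner_self_eq_zero (𝕜 := ℝ), inner_sub_right, h1, h2,
    sub_zero]

theorem inner_resid_succ (n : ℕ) (x x' : H) :
    ⟪resid y (n + 1) x, resid y (n + 1) x'⟫_ℝ = ⟪resid y n x, resid y n x'⟫_ℝ -
      ⟪resid y n (y n), resid y n x⟫_ℝ * ⟪resid y n (y n), resid y n x'⟫_ℝ /
        ⟪resid y n (y n), resid y n (y n)⟫_ℝ := by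
  rw [resid_succ, resid_succ, real_inner_self_eq_norm_sq]
  simp only [inner_sub_left, inner_sub_right, inner_smul_left, inner_smul_right,
    real_inner_self_eq_norm_sq, real_inner_comm (resid y n (y n)) (resid y n x)]
  by_cases h0 : resid y n (y n) = 0
  · simp [h0]
  · have : ‖resid y n (y n)‖ ^ 2 ≠ 0 := by simpa using h0
    simp only [map_mul, map_inv₀, conj_trivial]
    field_simp
    ring

/-- The determinant of the Gram matrix of two vectors. -/
noncomputable def gramDet (x x' : H) : ℝ := ⟪x, x⟫_ℝ * ⟪x', x'⟫_ℝ - ⟪x, x'⟫_ℝ ^ 2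

/-- One step of the recursion acts on the pair by a matrix of determinant `-b`, and a Gram
determinant scales by its square. The linear map `e` is held fixed along the recursion, so it can be
the estimator at the final time. -/
theorem gramDet_recursion {a b : ℝ} {V : ℕ → H}
    (hV : ∀ n, V (n + 2) = a • V (n + 1) + b • V n) (e : H →ₗ[ℝ] H) (n : ℕ) :
    gramDet (e (V n)) (e (V (n + 1))) = (b ^ 2) ^ n * gramDet (e (V 0)) (e (V 1)) := by
  induction n with
  | zero => simp
  | succ n ih =>
    rw [pow_succ', mul_assoc, ← ih, hV]
    simp only [map_add, map_smul, gramDet, inner_add_left, inner_add_right, inner_smul_left,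
      inner_smul_right, conj_trivial, real_inner_comm (e (V n)) (e (V (n + 1)))]
    ring

/-- The second order structure of a Gaussian vector-parameter problem: the messages obey a linear
recursion from two orthonormal vectors, and are orthogonal to the stationary noise `z`, which the
filter `l` whitens. -/
structure IsLinearModel (a b : ℝ) (p : ℕ) (l : ℕ → ℝ) (V z : ℕ → H) : Prop where
  rec_eq : ∀ n, V (n + 2) = a • V (n + 1) + b • V n
  inner_zero_zero : ⟪V 0, V 0⟫_ℝ = 1
  inner_zero_one : ⟪V 0, V 1⟫_ℝ = 0
  inner_one_one : ⟪V 1, V 1⟫_ℝ = 1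
  inner_zero_noise : ∀ j, ⟪V 0, z j⟫_ℝ = 0
  inner_one_noise : ∀ j, ⟪V 1, z j⟫_ℝ = 0
  stationary : ∀ i j, ⟪z (i + 1), z (j + 1)⟫_ℝ = ⟪z i, z j⟫_ℝ
  filter_zero : l 0 = 1
  white : ∀ n k, p ≤ n → k ≤ n →
    ∑ j ∈ Finset.range (p + 1), l j * ⟪z (n - j), z k⟫_ℝ = if k = n then 1 else 0

namespace IsLinearModel

variable {y} {a b : ℝ} {p : ℕ} {l : ℕ → ℝ} {V z : ℕ → H} (h : IsLinearModel a b p l V z)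
include h

theorem inner_noise (i j : ℕ) : ⟪V i, z j⟫_ℝ = 0 := by
  induction i using Nat.strong_induction_on with
  | _ i ih =>
    match i with
    | 0 => exact h.inner_zero_noise j
    | 1 => exact h.inner_one_noise j
    | i + 2 =>
      rw [h.rec_eq, inner_add_left, inner_smul_left, inner_smul_left, ih _ (by omega),
        ih _ (by omega)]
      simp

theorem inner_shift (k i j : ℕ) : ⟪z (i + k), z (j + k)⟫_ℝ = ⟪z i, z j⟫_ℝ := by
  induction k with
  | zero => rfl
  | succ k ih => rw [← ih, ← h.stationary (i + k)]; rfl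

omit h in
/-- The whitened noise. -/
def whitened (p : ℕ) (l : ℕ → ℝ) (z : ℕ → H) (n : ℕ) : H :=
  ∑ j ∈ Finset.range (p + 1), l j • z (n - j)

theorem inner_whitened {n k : ℕ} (hn : p ≤ n) (hk : k ≤ n) :
    ⟪whitened p l z n, z k⟫_ℝ = if k = n then 1 else 0 := by
  rw [← h.white n k hn hk, whitened, sum_inner]
  simp [inner_smul_left]

theorem inner_whitened_self {n : ℕ} (hn : p ≤ n) :
    ⟪whitened p l z n, whitened p l z n⟫_ℝ = 1 := by
  calc ⟪whitened p l z n, whitened p l z n⟫_ℝ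
      = ⟪whitened p l z n, ∑ j ∈ Finset.range (p + 1), l j • z (n - j)⟫_ℝ := rfl
    _ = 1 := ?_
  rw [inner_sum, Finset.sum_eq_single 0]
  · rw [inner_smul_right, h.inner_whitened hn (Nat.sub_le _ _), h.filter_zero]; simp
  · intro j hj hj0
    have := Finset.mem_range.1 hj
    rw [inner_smul_right, h.inner_whitened hn (Nat.sub_le _ _), if_neg (by omega), mul_zero]
  · simp

theorem inner_whitened_message {n : ℕ} (i : ℕ) : ⟪whitened p l z n, V i⟫_ℝ = 0 := by
  rw [whitened, sum_inner]
  refine Finset.sum_eq_zero fun j _ => ?_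
  rw [inner_smul_left, real_inner_comm, h.inner_noise, mul_zero]

/-- The whitened noise is orthogonal to all earlier noise and has inner product `1` with the current
one, so the last coefficient of a relation vanishes. -/
theorem noise_independent (n : ℕ) (α : ℕ → ℝ) (hα : ∑ j ∈ Finset.range n, α j • z j = 0) :
    ∀ j < n, α j = 0 := by
  induction n with
  | zero => simp
  | succ n ih =>
    -- Whitening needs `p` past values, so the relation is first shifted by `p`; stationarity
    -- preserves the norm of the combination.
    have hs : ∑ j ∈ Finset.range (n + 1), α j • z (j + p) = 0 := by
      rw [← inner_self_eq_zero (𝕜 := ℝ)]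
      have h0 : ⟪∑ j ∈ Finset.range (n + 1), α j • z j,
          ∑ j ∈ Finset.range (n + 1), α j • z j⟫_ℝ = 0 := by rw [hα, inner_zero_left]
      rw [← h0]
      simp only [sum_inner, inner_sum, inner_smul_left, inner_smul_right, h.inner_shift p]
    have hn : α n = 0 := by
      have h1 : ⟪whitened p l z (n + p), ∑ j ∈ Finset.range (n + 1), α j • z (j + p)⟫_ℝ = 0 := by
        rw [hs, inner_zero_right]
      rw [inner_sum, Finset.sum_range_succ, Finset.sum_eq_zero, zero_add, inner_smul_right,
        h.inner_whitened (by omega) le_rfl, if_pos rfl, mul_one] at h1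
      · exact h1
      · intro j hj
        have := Finset.mem_range.1 hj
        rw [inner_smul_right, h.inner_whitened (by omega) (by omega), if_neg (by omega), mul_zero]
    intro j hj
    rcases Nat.lt_succ_iff_lt_or_eq.1 hj with hj | rfl
    · refine ih ?_ j hj
      rwa [Finset.sum_range_succ, hn, zero_smul, add_zero] at hα
    · exact hn

/-- The noise part of a combination of observations is orthogonal to all the noise, hence zero;
independence of the noise then kills every coefficient. -/
theorem eq_zero_of_mem {n : ℕ} {k : H}
    (hk : k ∈ Submodule.span ℝ ((fun j => V j + z j) '' Set.Iio n)) (hz : ∀ j, ⟪k, z j⟫_ℝ = 0) :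
    k = 0 := by
  have himg : (fun j => V j + z j) '' Set.Iio n =
      Set.range (fun j : Fin n => V j + z j) := by
    ext x
    constructor
    · rintro ⟨j, hj, rfl⟩; exact ⟨⟨j, hj⟩, rfl⟩
    · rintro ⟨j, rfl⟩; exact ⟨j, j.2, rfl⟩
  rw [himg, Submodule.mem_span_range_iff_exists_fun] at hk
  obtain ⟨c, rfl⟩ := hk
  set α : ℕ → ℝ := fun j => if hj : j < n then c ⟨j, hj⟩ else 0 with hα
  have hsum : ∀ f : ℕ → H, ∑ j : Fin n, c j • f j = ∑ j ∈ Finset.range n, α j • f j := by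
    intro f
    rw [Finset.sum_range]
    simp [hα]
  have h0 : ∑ j ∈ Finset.range n, α j • z j = 0 := by
    have hzz : ∀ i, ⟪∑ j ∈ Finset.range n, α j • z j, z i⟫_ℝ = 0 := by
      intro i
      have := hz i
      rw [hsum (fun j => V j + z j)] at this
      simp only [smul_add, Finset.sum_add_distrib, inner_add_left] at this
      rw [sum_inner, Finset.sum_eq_zero, zero_add] at this
      · exact this
      · intro j _
        rw [inner_smul_left, h.inner_noise, mul_zero]
    rw [← inner_self_eq_zero (𝕜 := ℝ), inner_sum]
    exact Finset.sum_eq_zero fun j _ => by rw [inner_smul_right, hzz, mul_zero]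
  have := h.noise_independent n α h0
  rw [hsum (fun j => V j + z j)]
  exact Finset.sum_eq_zero fun j hj => by rw [this j (Finset.mem_range.1 hj), zero_smul]

omit h in
/-- The error covariance matrix of the next two messages, given `n` observations. -/
noncomputable def errCov (V z : ℕ → H) (n : ℕ) : Matrix (Fin 2) (Fin 2) ℝ :=
  let e := resid (fun j => V j + z j) n
  !![⟪e (V n), e (V n)⟫_ℝ, ⟪e (V n), e (V (n + 1))⟫_ℝ;
    ⟪e (V n), e (V (n + 1))⟫_ℝ, ⟪e (V (n + 1)), e (V (n + 1))⟫_ℝ]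

omit h in
theorem det_errCov (V z : ℕ → H) (n : ℕ) : (errCov V z n).det =
    gramDet (resid (fun j => V j + z j) n (V n)) (resid (fun j => V j + z j) n (V (n + 1))) := by
  simp [errCov, gramDet, Matrix.det_fin_two_of, sq]

theorem det_errCov_eq (n : ℕ) : (errCov V z n).det =
    (b ^ 2) ^ n * gramDet (resid (fun j => V j + z j) n (V 0)) (resid (fun j => V j + z j) n (V 1)) :=
  by rw [det_errCov, gramDet_recursion h.rec_eq]

/-- A message combination known exactly from the observations lies in their span and is orthogonal
to the noise, so it is zero. The messages have Gram determinant `b ^ (2 n) ≠ 0`, and Cramer's rule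
concludes. -/
theorem eq_zero_of_resid_eq_zero (hb : b ≠ 0) {n : ℕ} {c d : ℝ}
    (he : resid (fun j => V j + z j) n (c • V n + d • V (n + 1)) = 0) : c = 0 ∧ d = 0 := by
  have hmem := sub_resid_mem (fun j => V j + z j) n (c • V n + d • V (n + 1))
  rw [he, sub_zero] at hmem
  have h0 := h.eq_zero_of_mem hmem fun j => by
    simp [inner_add_left, inner_smul_left, h.inner_noise]
  have hg := gramDet_recursion h.rec_eq LinearMap.id n
  simp only [LinearMap.id_apply, gramDet, h.inner_zero_zero, h.inner_one_one,
    h.inner_zero_one] at hg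
  have hb' : (b ^ 2) ^ n ≠ 0 := by positivity
  have h1 : ⟪c • V n + d • V (n + 1), V n⟫_ℝ = 0 := by rw [h0, inner_zero_left]
  have h2 : ⟪c • V n + d • V (n + 1), V (n + 1)⟫_ℝ = 0 := by rw [h0, inner_zero_left]
  simp only [inner_add_left, inner_smul_left, conj_trivial] at h1 h2
  rw [real_inner_comm] at h2
  rw [real_inner_comm (V n) (V (n + 1))] at h1
  rw [real_inner_comm (V n) (V (n + 1))] at h2
  constructor
  · refine (mul_eq_zero.1 ?_).resolve_left hb'
    linear_combination (-c) * hg + ⟪V (n + 1), V (n + 1)⟫_ℝ * h1 - ⟪V n, V (n + 1)⟫_ℝ * h2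
  · refine (mul_eq_zero.1 ?_).resolve_left hb'
    linear_combination (-d) * hg + ⟪V n, V n⟫_ℝ * h2 - ⟪V n, V (n + 1)⟫_ℝ * h1

theorem det_errCov_pos (hb : b ≠ 0) (n : ℕ) : 0 < (errCov V z n).det := by
  set e := resid (fun j => V j + z j) n with he
  have hpos : ∀ c d : ℝ, (c ≠ 0 ∨ d ≠ 0) → 0 < ⟪e (c • V n + d • V (n + 1)),
      e (c • V n + d • V (n + 1))⟫_ℝ := by
    intro c d hcd
    rw [real_inner_self_eq_norm_sq]
    have : e (c • V n + d • V (n + 1)) ≠ 0 := fun h0 => by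
      have := h.eq_zero_of_resid_eq_zero hb h0
      tauto
    positivity
  have h1 : 0 < ⟪e (V n), e (V n)⟫_ℝ := by simpa using hpos 1 0 (by simp)
  -- The squared norm of this combination is the first diagonal entry times the determinant.
  have h2 := hpos (-⟪e (V n), e (V (n + 1))⟫_ℝ) ⟪e (V n), e (V n)⟫_ℝ (Or.inr h1.ne')
  rw [det_errCov, ← he, gramDet]
  simp only [map_add, map_smul, inner_add_left, inner_add_right, inner_smul_left,
    inner_smul_right, conj_trivial, real_inner_comm (e (V n)) (e (V (n + 1)))] at h2
  refine (mul_pos_iff_of_pos_left h1).1 ?_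
  linear_combination h2

theorem message_eq (hb : b ≠ 0) (k m : ℕ) :
    V m = (Matrix.mulVec (invCompanion a b ^ k) ![1, 0]) 0 • V (m + k) +
      (Matrix.mulVec (invCompanion a b ^ k) ![1, 0]) 1 • V (m + k + 1) := by
  induction k with
  | zero => simp
  | succ k ih =>
    rw [pow_succ', ← Matrix.mulVec_mulVec]
    set v := Matrix.mulVec (invCompanion a b ^ k) ![1, 0]
    have h0 : (Matrix.mulVec (invCompanion a b) v) 0 = -a / b * v 0 + v 1 := by
      simp [invCompanion, Matrix.mulVec, dotProduct, Fin.sum_univ_two]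
    have h1 : (Matrix.mulVec (invCompanion a b) v) 1 = 1 / b * v 0 := by
      simp [invCompanion, Matrix.mulVec, dotProduct, Fin.sum_univ_two]
    rw [h0, h1, show m + (k + 1) + 1 = m + k + 2 by ring, show m + (k + 1) = m + k + 1 by ring,
      h.rec_eq, ih]
    match_scalars <;> field_simp
    ring

theorem filter_message_eq (hb : b ≠ 0) {n : ℕ} (hn : p ≤ n) {u : Fin 2 → ℝ}
    (hu : u = ∑ k ∈ Finset.range (p + 1),
      l k • Matrix.mulVec (invCompanion a b ^ k) ![1, 0]) :
    ∑ j ∈ Finset.range (p + 1), l j • V (n - j) = u 0 • V n + u 1 • V (n + 1) := by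
  rw [hu]
  simp only [Finset.sum_apply, Pi.smul_apply, Finset.sum_smul, ← Finset.sum_add_distrib]
  refine Finset.sum_congr rfl fun j hj => ?_
  have hj := Finset.mem_range.1 hj
  rw [h.message_eq hb j (n - j), Nat.sub_add_cancel (by omega), smul_add, smul_smul, smul_smul,
    smul_eq_mul, smul_eq_mul]

/-- Since `l 0 = 1`, the current observation and the filtered observations differ by past
observations, which have residual `0`. The whitened noise is orthogonal to the past and so is its
own residual; `p ≤ n` keeps the subtractions `n - j` genuine. -/
theorem resid_observation {n : ℕ} (hn : p ≤ n) :
    resid (fun j => V j + z j) n (V n + z n) =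
      resid (fun j => V j + z j) n (∑ j ∈ Finset.range (p + 1), l j • V (n - j)) +
        whitened p l z n := by
  have h1 : resid (fun j => V j + z j) n (whitened p l z n) = whitened p l z n := by
    refine resid_of_inner_eq_zero _ fun j hj => ?_
    rw [real_inner_comm, inner_add_right, h.inner_whitened_message, h.inner_whitened hn hj.le,
      if_neg hj.ne, zero_add]
  conv_rhs => rw [← h1, ← map_add]
  rw [← sub_eq_zero, ← map_sub]
  refine resid_of_mem _ ?_
  rw [whitened, ← Finset.sum_add_distrib, Finset.sum_range_succ', h.filter_zero]
  simp only [Nat.sub_zero, one_smul, sub_add_cancel_right, ← smul_add]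
  refine Submodule.neg_mem _ (Submodule.sum_mem _ fun j hj => Submodule.smul_mem _ _ ?_)
  have := Finset.mem_range.1 hj
  exact Submodule.subset_span ⟨n - (j + 1), by simp only [Set.mem_Iio]; omega, rfl⟩

theorem inner_whitened_resid {n : ℕ} (hn : p ≤ n) {x : H}
    (hx : ⟪whitened p l z n, x⟫_ℝ = 0) :
    ⟪whitened p l z n, resid (fun j => V j + z j) n x⟫_ℝ = 0 := by
  have := inner_of_mem_span (y := fun j => V j + z j) (n := n) (x := whitened p l z n)
    (fun j hj => by
      rw [real_inner_comm, inner_add_right, h.inner_whitened_message, h.inner_whitened hn hj.le,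
        if_neg hj.ne, zero_add]) (sub_resid_mem (fun j => V j + z j) n x)
  rw [real_inner_comm, inner_sub_right, hx] at this
  linarith

omit h in
-- Sherman–Morrison: the measurement update `Q - Q u uᵀ Q / (uᵀ Q u + 1)` has inverse `Q⁻¹ + u uᵀ`.
-- The time update is a congruence by the companion matrix, so it becomes a congruence by `C` on
-- inverses.
theorem riccati_inv {q₀ q₁ q₂ u₀ u₁ d S : ℝ} (hb : b ≠ 0) (hd : d = q₀ * q₂ - q₁ ^ 2)
    (hd0 : d ≠ 0)
    (hS : S = u₀ * (u₀ * q₀ + u₁ * q₁) + u₁ * (u₀ * q₁ + u₁ * q₂) + 1) (hS0 : S ≠ 0)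
    {r₀ r₁ r₂ : ℝ} (h₀ : r₀ = q₀ - (u₀ * q₀ + u₁ * q₁) * (u₀ * q₀ + u₁ * q₁) / S)
    (h₁ : r₁ = q₁ - (u₀ * q₀ + u₁ * q₁) * (u₀ * q₁ + u₁ * q₂) / S)
    (h₂ : r₂ = q₂ - (u₀ * q₁ + u₁ * q₂) * (u₀ * q₁ + u₁ * q₂) / S) {u : Fin 2 → ℝ}
    (hu₀ : u 0 = u₀) (hu₁ : u 1 = u₁) :
    (!![r₂, a * r₂ + b * r₁; a * r₂ + b * r₁,
        a * (a * r₂ + b * r₁) + b * (a * r₁ + b * r₀)])⁻¹ =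
      lyapStep (invCompanion a b) u (!![q₀, q₁; q₁, q₂])⁻¹ := by
  have hQ : (!![q₀, q₁; q₁, q₂])⁻¹ = !![q₂ / d, -q₁ / d; -q₁ / d, q₀ / d] := by
    refine Matrix.inv_eq_right_inv ?_
    ext i j
    fin_cases i <;> fin_cases j <;> simp [Matrix.mul_apply, Fin.sum_univ_two] <;> field_simp <;>
      simp only [hd] <;> ring
  rw [hQ]
  have hR : !![r₀, r₁; r₁, r₂] * (!![q₂ / d, -q₁ / d; -q₁ / d, q₀ / d] +
      Matrix.vecMulVec u u) = 1 := by
    ext i j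
    fin_cases i <;> fin_cases j <;>
      simp [Matrix.mul_apply, Fin.sum_univ_two, Matrix.vecMulVec_apply, hu₀, hu₁, h₀, h₁, h₂] <;>
      field_simp <;> simp only [hS, hd] <;> ring
  have hB : !![0, b; 1, a] * invCompanion a b = 1 := by
    ext i j
    fin_cases i <;> fin_cases j <;>
      simp [Matrix.mul_apply, Fin.sum_univ_two, invCompanion, hb]
    field_simp
    ring
  have hBT : !![0, 1; b, a] * (invCompanion a b).transpose = 1 := by
    ext i j
    fin_cases i <;> fin_cases j <;>
      simp [Matrix.mul_apply, Fin.sum_univ_two, invCompanion, hb]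
    field_simp
    ring
  have hprod : !![r₂, a * r₂ + b * r₁; a * r₂ + b * r₁,
      a * (a * r₂ + b * r₁) + b * (a * r₁ + b * r₀)] =
      !![0, 1; b, a] * !![r₀, r₁; r₁, r₂] * !![0, b; 1, a] := by
    ext i j
    fin_cases i <;> fin_cases j <;> simp [Matrix.mul_apply, Fin.sum_univ_two] <;> ring
  refine Matrix.inv_eq_right_inv ?_
  set X := !![q₂ / d, -q₁ / d; -q₁ / d, q₀ / d] + Matrix.vecMulVec u u with hX
  calc _ = !![0, 1; b, a] * (!![r₀, r₁; r₁, r₂] * ((!![0, b; 1, a] * invCompanion a b) * X)) *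
        (invCompanion a b).transpose := by
        rw [hprod, lyapStep, ← hX]
        simp only [Matrix.mul_assoc]
    _ = 1 := by rw [hB, Matrix.one_mul, hR, Matrix.mul_one, hBT]

theorem errCov_inv_succ (hb : b ≠ 0) {n : ℕ} (hn : p ≤ n) {u : Fin 2 → ℝ}
    (hu : u = ∑ k ∈ Finset.range (p + 1),
      l k • Matrix.mulVec (invCompanion a b ^ k) ![1, 0]) :
    (errCov V z (n + 1))⁻¹ = lyapStep (invCompanion a b) u (errCov V z n)⁻¹ := by
  have hobs := h.resid_observation hn
  rw [h.filter_message_eq hb hn hu] at hobs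
  have hdet := (h.det_errCov_pos hb n).ne'
  have hstep := inner_resid_succ (fun j => V j + z j) n
  have hw0 := h.inner_whitened_resid hn (h.inner_whitened_message (n := n) n)
  have hw1 := h.inner_whitened_resid hn (h.inner_whitened_message (n := n) (n + 1))
  have hww := h.inner_whitened_self hn
  rw [det_errCov] at hdet
  simp only [errCov, h.rec_eq n]
  set e := resid (fun j => V j + z j) n with he
  set e' := resid (fun j => V j + z j) (n + 1) with he'
  set W := whitened p l z n with hW
  rw [map_add e (u 0 • V n), map_smul, map_smul] at hobs
  have hc0 : ⟪e (V n + z n), e (V n)⟫_ℝ =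
      u 0 * ⟪e (V n), e (V n)⟫_ℝ + u 1 * ⟪e (V n), e (V (n + 1))⟫_ℝ := by
    rw [hobs]
    simp only [inner_add_left, inner_smul_left, conj_trivial, hw0,
      real_inner_comm (e (V n)) (e (V (n + 1))), add_zero]
  have hc1 : ⟪e (V n + z n), e (V (n + 1))⟫_ℝ =
      u 0 * ⟪e (V n), e (V (n + 1))⟫_ℝ + u 1 * ⟪e (V (n + 1)), e (V (n + 1))⟫_ℝ := by
    rw [hobs]
    simp only [inner_add_left, inner_smul_left, conj_trivial, hw1, add_zero]
  have hS : ⟪e (V n + z n), e (V n + z n)⟫_ℝ =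
      u 0 * (u 0 * ⟪e (V n), e (V n)⟫_ℝ + u 1 * ⟪e (V n), e (V (n + 1))⟫_ℝ) +
      u 1 * (u 0 * ⟪e (V n), e (V (n + 1))⟫_ℝ + u 1 * ⟪e (V (n + 1)), e (V (n + 1))⟫_ℝ) + 1 := by
    rw [← hc0, ← hc1]
    nth_rewrite 2 [hobs]
    rw [inner_add_right, inner_add_right, inner_smul_right, inner_smul_right]
    congr 1
    rw [hobs, inner_add_left, inner_add_left, inner_smul_left, inner_smul_left, hww,
      real_inner_comm, hw0, real_inner_comm, hw1]
    simp
  have hSpos : ⟪e (V n + z n), e (V n + z n)⟫_ℝ ≠ 0 := by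
    have h1 : (0 : ℝ) ≤ ⟪u 0 • e (V n) + u 1 • e (V (n + 1)),
      u 0 • e (V n) + u 1 • e (V (n + 1))⟫_ℝ := real_inner_self_nonneg
    simp only [inner_add_left, inner_add_right, inner_smul_left, inner_smul_right, conj_trivial,
      real_inner_comm (e (V n)) (e (V (n + 1)))] at h1
    rw [hS]
    nlinarith
  rw [← riccati_inv (a := a) (b := b) (r₀ := ⟪e' (V n), e' (V n)⟫_ℝ)
    (r₁ := ⟪e' (V n), e' (V (n + 1))⟫_ℝ) (r₂ := ⟪e' (V (n + 1)), e' (V (n + 1))⟫_ℝ)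
    hb rfl hdet hS hSpos (by rw [← hc0]; exact hstep (V n) (V n))
    (by rw [← hc0, ← hc1]; exact hstep (V n) (V (n + 1)))
    (by rw [← hc1]; exact hstep (V (n + 1)) (V (n + 1))) rfl rfl]
  simp only [map_add, map_smul, inner_add_left, inner_add_right, inner_smul_left,
    inner_smul_right, conj_trivial, real_inner_comm (e' (V n)) (e' (V (n + 1)))]

end IsLinearModel

end LeastSquares

/-! ### Asymptotics of the estimation errors -/

section Asymptotics

open scoped InnerProductSpace

variable {H : Type*} [NormedAddCommGroup H] [InnerProductSpace ℝ H]
  {p : ℕ} {β : Fin p → ℂ} {a b : ℝ} {x y : ℂ} {V z : ℕ → H}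

theorem IsLinearModel.tendsto_errCov (hβ : IsARParam β) (hr : AreCharRoots a b x y)
    (hx : 1 < ‖x‖) (hy : 1 < ‖y‖)
    (h : IsLinearModel a b p (fun k => ((arPoly β).coeff k).re) V z) :
    Tendsto (fun n => ‖resid (fun j => V j + z j) n (V n)‖ ^ 2) atTop (𝓝 (power β x y)) ∧
      ∃ d : ℝ, 0 < d ∧ Tendsto (fun n => (IsLinearModel.errCov V z n).det) atTop (𝓝 d) := by
  obtain ⟨N, h11, hdet, hmap, hlim⟩ := exists_lyapLimit hβ hr hx hy
  have hb := hr.ne_zero hx hy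
  -- The recursion for the inverses holds only from time `p` on, which suffices since the limit does
  -- not depend on the start.
  have hN := hlim (fun n => (IsLinearModel.errCov V z n)⁻¹) p fun n hn =>
    h.errCov_inv_succ hb hn rfl
  have hc : Continuous fun A : Matrix (Fin 2) (Fin 2) ℝ => A.det := continuous_id.matrix_det
  have hd : Tendsto (fun n => (IsLinearModel.errCov V z n)⁻¹.det) atTop (𝓝 N.det) :=
    (hc.tendsto _).comp hN
  have hu : ∀ n, IsUnit (IsLinearModel.errCov V z n).det := fun n =>
    (h.det_errCov_pos hb n).ne'.isUnit
  constructor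
  · have e11 : Tendsto (fun n => (IsLinearModel.errCov V z n)⁻¹ 1 1) atTop (𝓝 (N 1 1)) :=
      tendsto_pi_nhds.1 (tendsto_pi_nhds.1 hN 1) 1
    rw [(hr.power_eq_div hβ hx hy hmap).1]
    refine (e11.div hd hdet.ne').congr fun n => ?_
    have h1 : (IsLinearModel.errCov V z n)⁻¹ 1 1 = ((IsLinearModel.errCov V z n).det)⁻¹ *
        (IsLinearModel.errCov V z n) 0 0 := by
      rw [Matrix.inv_def, Matrix.adjugate_fin_two, Ring.inverse_eq_inv']
      simp
    have h2 : (IsLinearModel.errCov V z n) 0 0 = ‖resid (fun j => V j + z j) n (V n)‖ ^ 2 := by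
      rw [← real_inner_self_eq_norm_sq]; rfl
    rw [Pi.div_apply, h1, Matrix.det_nonsing_inv, Ring.inverse_eq_inv', h2,
      mul_div_cancel_left₀ _ (inv_ne_zero (hu n).ne_zero)]
  · refine ⟨N.det⁻¹, inv_pos.2 hdet, (hd.inv₀ hdet.ne').congr fun n => ?_⟩
    rw [Matrix.det_nonsing_inv, Ring.inverse_eq_inv', inv_inv]

/-- By `det_errCov_eq`, the logarithm of this Gram determinant is `log (det Q n) - 2 n log |b|`. The
first term converges, so division by `n` removes it. -/
theorem IsLinearModel.tendsto_log_gramDet (hβ : IsARParam β) (hr : AreCharRoots a b x y)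
    (hx : 1 < ‖x‖) (hy : 1 < ‖y‖)
    (h : IsLinearModel a b p (fun k => ((arPoly β).coeff k).re) V z) :
    (∀ n, 0 < gramDet (resid (fun j => V j + z j) n (V 0))
      (resid (fun j => V j + z j) n (V 1))) ∧
    Tendsto (fun n : ℕ => -(1 / 2) * Real.log (gramDet (resid (fun j => V j + z j) n (V 0))
      (resid (fun j => V j + z j) n (V 1))) / n) atTop (𝓝 (Real.log |b|)) := by
  obtain ⟨-, d, hd, hlim⟩ := h.tendsto_errCov hβ hr hx hy
  have hb := hr.ne_zero hx hy
  have hb2 : ∀ n : ℕ, 0 < (b ^ 2) ^ n := fun n => by positivity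
  have hpos : ∀ n, 0 < gramDet (resid (fun j => V j + z j) n (V 0))
      (resid (fun j => V j + z j) n (V 1)) := fun n => by
    have := h.det_errCov_pos hb n
    rw [h.det_errCov_eq] at this
    exact (mul_pos_iff_of_pos_left (hb2 n)).1 this
  refine ⟨hpos, ?_⟩
  have hlog := ((Real.continuousAt_log hd.ne').tendsto.comp hlim).div_atTop
    (tendsto_natCast_atTop_atTop (R := ℝ))
  have := (hlog.const_mul (-(1 / 2))).add_const (Real.log |b|)
  rw [mul_zero, zero_add] at this
  refine this.congr' ?_
  filter_upwards [eventually_gt_atTop 0] with n hn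
  have hn' : (n : ℝ) ≠ 0 := by positivity
  rw [Function.comp_apply, h.det_errCov_eq, Real.log_mul (hb2 n).ne' (hpos n).ne', Real.log_pow,
    Real.log_pow, Real.log_abs]
  field_simp
  push_cast
  ring

theorem rate_le_log (hr : AreCharRoots a b x y) (hx : 1 < ‖x‖) (hy : 1 < ‖y‖) :
    rate x y ≤ Real.log |b| := by
  have hb : |b| = ‖x‖ * ‖y‖ := by
    rw [← norm_mul, hr.mul_eq, norm_neg, Complex.norm_real, Real.norm_eq_abs]
  rw [hb, Real.log_mul (by linarith) (by linarith), rate]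
  have hm : 0 < min ‖x‖ ‖y‖ := lt_min (by linarith) (by linarith)
  have h1 := Real.log_le_log hm (min_le_left _ _)
  have h2 := Real.log_le_log hm (min_le_right _ _)
  linarith

end Asymptotics

/-! ### Whitening of the autoregressive noise -/

section Whitening

variable {p : ℕ} {β : Fin p → ℂ}

/-- Mean value property: the function is holomorphic on the closed disc, where `L_Z` has no zero,
and `L_Z(0) = 1`. -/
theorem circleAverage_pow_div (hβ : IsARParam β) (m : ℕ) :
    Real.circleAverage (fun w => w ^ m / (arPoly β).eval w) 0 1 = if m = 0 then 1 else 0 := by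
  have hd : DiffContOnCl ℂ (fun w => w ^ m / (arPoly β).eval w) (Metric.ball 0 |1|) := by
    refine DifferentiableOn.diffContOnCl fun w hw => ?_
    rw [abs_one, closure_ball _ one_ne_zero, mem_closedBall_zero_iff] at hw
    exact ((differentiableAt_id.pow m).div (arPoly β).differentiableAt
      (hβ.eval_ne_zero hw)).differentiableWithinAt
  rw [hd.circleAverage]
  have : (arPoly β).eval 0 = 1 := by
    rw [← Polynomial.coeff_zero_eq_eval_zero, arPoly_coeff_zero]
  simp [this, zero_pow_eq]

theorem norm_exp_mul_I (θ : ℝ) : ‖Complex.exp (θ * Complex.I)‖ ≤ 1 :=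
  (Complex.norm_exp_ofReal_mul_I θ).le

theorem ofReal_arSpectrum (hβ : IsARParam β) (θ : ℝ) : (arSpectrum β θ : ℂ) =
    1 / ((arPoly β).eval (Complex.exp (θ * Complex.I)) *
      (arPoly β).eval (Complex.exp (-(θ * Complex.I)))) := by
  have : Complex.exp (-(θ * Complex.I)) = (starRingEnd ℂ) (Complex.exp (θ * Complex.I)) := by
    rw [← Complex.exp_conj]; simp
  rw [this, ← hβ.conj_eval, Complex.mul_conj, arSpectrum, Complex.normSq_eq_norm_sq]
  push_cast
  rfl

theorem continuous_ofReal_arSpectrum (hβ : IsARParam β) :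
    Continuous fun θ : ℝ => (arSpectrum β θ : ℂ) := by
  simp_rw [ofReal_arSpectrum hβ]
  refine continuous_const.div ?_ fun θ => mul_ne_zero (hβ.eval_ne_zero (norm_exp_mul_I θ))
    (hβ.eval_ne_zero ?_)
  · exact ((arPoly β).continuous.comp (by fun_prop)).mul ((arPoly β).continuous.comp (by fun_prop))
  · have := norm_exp_mul_I (-θ)
    push_cast at this
    rwa [neg_mul] at this

theorem IsARNoise.stationary {Ω : Type*} [MeasurableSpace Ω] {μ : Measure Ω} {Z : ℕ → Ω → ℝ}
    (hZ : IsARNoise μ β Z) (i j : ℕ) :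
    ∫ ω, Z (i + 1) ω * Z (j + 1) ω ∂μ = ∫ ω, Z i ω * Z j ω ∂μ := by
  have := hZ.covariance_eq (i + 1) (j + 1)
  push_cast at this
  rw [add_sub_add_right_eq_sub, ← hZ.covariance_eq i j] at this
  exact_mod_cast this

/-- Summing the covariances against the filter puts `L_Z(e^{-iθ})` under the integral, which cancels
one factor of the spectral density. What remains is the circle average of `w ^ (n - k) / L_Z(w)`,
whose exponent is nonnegative because `k ≤ n`. -/
theorem IsARNoise.white {Ω : Type*} [MeasurableSpace Ω] {μ : Measure Ω} {Z : ℕ → Ω → ℝ}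
    (hβ : IsARParam β) (hZ : IsARNoise μ β Z) {n k : ℕ} (hn : p ≤ n) (hk : k ≤ n) :
    ∑ j ∈ Finset.range (p + 1), ((arPoly β).coeff j).re * ∫ ω, Z (n - j) ω * Z k ω ∂μ =
      if k = n then 1 else 0 := by
  have hcast : ((∑ j ∈ Finset.range (p + 1),
      ((arPoly β).coeff j).re * ∫ ω, Z (n - j) ω * Z k ω ∂μ : ℝ) : ℂ) =
      Real.circleAverage (fun w => w ^ (n - k) / (arPoly β).eval w) 0 1 := by
    rw [Real.circleAverage_eq_integral_add (-Real.pi),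
      intervalIntegral.integral_comp_add_right (fun θ : ℝ =>
        (circleMap 0 1 θ) ^ (n - k) / (arPoly β).eval (circleMap 0 1 θ)),
      show 0 + -Real.pi = -Real.pi by ring, show 2 * Real.pi + -Real.pi = Real.pi by ring]
    have hterm : ∀ j ∈ Finset.range (p + 1),
        ((((arPoly β).coeff j).re * ∫ ω, Z (n - j) ω * Z k ω ∂μ : ℝ) : ℂ) =
        1 / (2 * Real.pi) * ∫ θ in (-Real.pi)..Real.pi, (arPoly β).coeff j *
          (Complex.exp (((n - k : ℕ) : ℂ) * θ * Complex.I) *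
            Complex.exp (-(θ * Complex.I)) ^ j * (arSpectrum β θ : ℂ)) := by
      intro j hj
      have hj := Finset.mem_range.1 hj
      rw [Complex.ofReal_mul, ← hβ.coeff_eq, hZ.covariance_eq,
        intervalIntegral.integral_const_mul, mul_left_comm]
      congr 2
      refine intervalIntegral.integral_congr fun θ _ => ?_
      rw [← Complex.exp_nat_mul, ← Complex.exp_add, Nat.cast_sub hk, Nat.cast_sub (by omega)]
      congr 2
      ring
    rw [Complex.ofReal_sum, Finset.sum_congr rfl hterm, ← Finset.mul_sum,
      ← intervalIntegral.integral_finsetSum]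
    · rw [Complex.real_smul]
      congr 1
      · push_cast; rw [one_div]
      refine intervalIntegral.integral_congr fun θ _ => ?_
      simp only [circleMap, Complex.ofReal_one, one_mul, zero_add]
      have h1 := hβ.eval_ne_zero (norm_exp_mul_I θ)
      have h2 : (arPoly β).eval (Complex.exp (-(θ * Complex.I))) ≠ 0 := hβ.eval_ne_zero (by
        have := norm_exp_mul_I (-θ)
        push_cast at this
        rwa [neg_mul] at this)
      calc _ = (∑ j ∈ Finset.range (p + 1), (arPoly β).coeff j *
            Complex.exp (-(θ * Complex.I)) ^ j) *
            (Complex.exp (((n - k : ℕ) : ℂ) * θ * Complex.I) * (arSpectrum β θ : ℂ)) := by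
            rw [Finset.sum_mul]
            exact Finset.sum_congr rfl fun j _ => by ring
        _ = _ := by
            rw [← eval_arPoly, ofReal_arSpectrum hβ, ← Complex.exp_nat_mul, mul_assoc]
            field_simp
    · intro j _
      refine Continuous.intervalIntegrable ?_ _ _
      have := continuous_ofReal_arSpectrum hβ
      fun_prop
  rw [circleAverage_pow_div hβ] at hcast
  have : (n - k = 0) ↔ k = n := by omega
  simp only [this] at hcast
  split_ifs at hcast ⊢ <;> exact_mod_cast hcast

end Whitening

/-! ### Mutual information of a Gaussian pair and its estimate -/

section MutualInfo

/-- The density of the normal law with mean `m` and standard deviation `σ` with respect to the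
standard normal law. -/
noncomputable def gaussRatio (m σ x : ℝ) : ℝ :=
  σ⁻¹ * Real.exp (x ^ 2 / 2 - (x - m) ^ 2 / (2 * σ ^ 2))

theorem gaussRatio_pos {m σ x : ℝ} (hσ : 0 < σ) : 0 < gaussRatio m σ x := by
  unfold gaussRatio; positivity

@[fun_prop]
theorem measurable_gaussRatio {α : Type*} [MeasurableSpace α] {f g : α → ℝ} (σ : ℝ)
    (hf : Measurable f) (hg : Measurable g) : Measurable fun x => gaussRatio (f x) σ (g x) := by
  unfold gaussRatio; fun_prop

theorem log_gaussRatio {m σ g : ℝ} (hσ : 0 < σ) :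
    Real.log (gaussRatio m σ (m + σ * g)) = -Real.log σ + (m + σ * g) ^ 2 / 2 - g ^ 2 / 2 := by
  rw [gaussRatio, Real.log_mul (by positivity) (by positivity), Real.log_exp, Real.log_inv]
  field_simp
  ring

theorem lintegral_gaussian_affine {σ : ℝ} (hσ : 0 < σ) (m : ℝ) {f : ℝ → ℝ≥0∞} (hf : Measurable f) :
    ∫⁻ g, f (m + σ * g) ∂gaussianReal 0 1 =
      ∫⁻ u, ENNReal.ofReal (gaussRatio m σ u) * f u ∂gaussianReal 0 1 := by
  have hmap : (gaussianReal 0 1).map (fun g => m + σ * g) =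
      gaussianReal m (NNReal.mk (σ ^ 2) (sq_nonneg σ)) := by
    have : (fun g => m + σ * g) = (fun g => m + g) ∘ (fun g => σ * g) := rfl
    rw [this, ← Measure.map_map (by fun_prop) (by fun_prop), gaussianReal_map_const_mul,
      gaussianReal_map_const_add]
    simp
  rw [← lintegral_map (f := f) (g := fun g => m + σ * g) hf (by fun_prop), hmap,
    gaussianReal_of_var_ne_zero _ (by simp [← NNReal.coe_eq_zero, hσ.ne']),
    gaussianReal_of_var_ne_zero _ one_ne_zero,
    lintegral_withDensity_eq_lintegral_mul _ (by fun_prop) hf,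
    lintegral_withDensity_eq_lintegral_mul _ (by fun_prop) (by fun_prop)]
  refine lintegral_congr fun x => ?_
  simp only [Pi.mul_apply, ← mul_assoc]
  congr 1
  rw [gaussianPDF, gaussianPDF, ← ENNReal.ofReal_mul (gaussianPDFReal_nonneg _ _ _)]
  congr 1
  simp only [gaussianPDFReal, gaussRatio, NNReal.coe_mk, NNReal.coe_one, mul_one, sub_zero]
  rw [Real.sqrt_mul (by positivity), Real.sqrt_sq hσ.le, mul_inv]
  have : Real.exp (-(x - m) ^ 2 / (2 * σ ^ 2)) =
      Real.exp (-x ^ 2 / 2) * Real.exp (x ^ 2 / 2 - (x - m) ^ 2 / (2 * σ ^ 2)) := by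
    rw [← Real.exp_add]; congr 1; ring
  rw [this]
  ring

theorem integrable_sq_of_hasLaw {Ω : Type*} [MeasurableSpace Ω] {μ : Measure Ω} {U : Ω → ℝ}
    (hU : HasLaw U (gaussianReal 0 1) μ) :
    Integrable (fun ω => U ω ^ 2) μ ∧ ∫ ω, U ω ^ 2 ∂μ = 1 := by
  have hm := hU.hasGaussianLaw.memLp_two
  refine ⟨hm.integrable_sq, ?_⟩
  have hprob := hU.hasGaussianLaw.isProbabilityMeasure
  have h1 : Var[U; μ] = 1 := by rw [hU.variance_eq]; simp
  have h0 : μ[U] = 0 := by rw [hU.integral_eq]; simp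
  rw [variance_of_integral_eq_zero hU.aemeasurable h0] at h1
  exact h1

variable {Ω E F : Type*} [MeasurableSpace Ω] [MeasurableSpace E] [MeasurableSpace F]
  {μ : Measure Ω} [IsProbabilityMeasure μ]

theorem mutualInfo_eq_of_density {A : Ω → E} {B : Ω → F} (hA : Measurable A) (hB : Measurable B)
    {r : E × F → ℝ} (hr : Measurable r) (hr0 : ∀ x, 0 < r x)
    (hd : μ.map (fun ω => (A ω, B ω)) =
      ((μ.map A).prod (μ.map B)).withDensity (fun x => ENNReal.ofReal (r x)))
    (hint : Integrable (fun ω => Real.log (r (A ω, B ω))) μ) :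
    mutualInfo μ A B = ENNReal.ofReal (∫ ω, Real.log (r (A ω, B ω)) ∂μ) := by
  have hAB : Measurable fun ω => (A ω, B ω) := hA.prodMk hB
  have := Measure.isProbabilityMeasure_map (μ := μ) hA.aemeasurable
  have := Measure.isProbabilityMeasure_map (μ := μ) hB.aemeasurable
  have := Measure.isProbabilityMeasure_map (μ := μ) hAB.aemeasurable
  have hac : μ.map (fun ω => (A ω, B ω)) ≪ (μ.map A).prod (μ.map B) := by
    rw [hd]; exact withDensity_absolutelyContinuous _ _
  have hrn : (μ.map (fun ω => (A ω, B ω))).rnDeriv ((μ.map A).prod (μ.map B))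
      =ᵐ[(μ.map A).prod (μ.map B)] fun x => ENNReal.ofReal (r x) := by
    rw [hd]; exact Measure.rnDeriv_withDensity _ (by fun_prop)
  have hllr : llr (μ.map (fun ω => (A ω, B ω))) ((μ.map A).prod (μ.map B))
      =ᵐ[μ.map (fun ω => (A ω, B ω))] fun x => Real.log (r x) := by
    filter_upwards [hac.ae_le hrn] with x hx
    rw [llr, hx, ENNReal.toReal_ofReal (hr0 x).le]
  have hmeas : AEStronglyMeasurable (fun x => Real.log (r x)) (μ.map (fun ω => (A ω, B ω))) :=
    hr.log.aestronglyMeasurable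
  have hi : Integrable (llr (μ.map (fun ω => (A ω, B ω))) ((μ.map A).prod (μ.map B)))
      (μ.map (fun ω => (A ω, B ω))) := by
    rw [integrable_congr hllr, integrable_map_measure hmeas hAB.aemeasurable]
    exact hint
  rw [mutualInfo, InformationTheory.klDiv_of_ac_of_integrable hac hi, integral_congr_ae hllr,
    integral_map hAB.aemeasurable hmeas]
  simp

/-- Given `B`, the symbols are a triangular affine image of a standard Gaussian pair independent of
`B`, so the joint law has density `r` against the product law. The maps `φ, ψ` let the whole message
block replace the two symbols that determine it. -/
theorem mutualInfo_gaussian {U₁ U₂ G₁ G₂ : Ω → ℝ} (hU₁m : Measurable U₁) (hU₂m : Measurable U₂)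
    (hU₁ : HasLaw U₁ (gaussianReal 0 1) μ) (hU₂ : HasLaw U₂ (gaussianReal 0 1) μ)
    (hUi : IndepFun U₁ U₂ μ) {φ : ℝ × ℝ → E} (hφ : Measurable φ) {ψ : E → ℝ × ℝ}
    (hψ : Measurable ψ) (hψφ : ∀ u, ψ (φ u) = u) {B : Ω → F} (hB : Measurable B)
    {ζ₁ ζ₂ : F → ℝ} (hζ₁ : Measurable ζ₁) (hζ₂ : Measurable ζ₂)
    (hG₁m : Measurable G₁) (hG₂m : Measurable G₂)
    (hG₁ : HasLaw G₁ (gaussianReal 0 1) μ) (hG₂ : HasLaw G₂ (gaussianReal 0 1) μ)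
    (hGi : IndepFun G₁ G₂ μ) (hGB : IndepFun (fun ω => (G₁ ω, G₂ ω)) B μ)
    {σ₁ σ₂ κ : ℝ} (hσ₁ : 0 < σ₁) (hσ₂ : 0 < σ₂)
    (h₁ : ∀ ω, U₁ ω = ζ₁ (B ω) + σ₁ * G₁ ω)
    (h₂ : ∀ ω, U₂ ω = ζ₂ (B ω) + κ * G₁ ω + σ₂ * G₂ ω) :
    mutualInfo μ (fun ω => φ (U₁ ω, U₂ ω)) B = ENNReal.ofReal (-Real.log σ₁ - Real.log σ₂) := by
  set r : E × F → ℝ := fun x => gaussRatio (ζ₁ x.2) σ₁ (ψ x.1).1 *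
    gaussRatio (ζ₂ x.2 + κ * (((ψ x.1).1 - ζ₁ x.2) / σ₁)) σ₂ (ψ x.1).2 with hr
  have hrm : Measurable r := by fun_prop
  have hUm : Measurable fun ω => (U₁ ω, U₂ ω) := hU₁m.prodMk hU₂m
  have hGm : Measurable fun ω => (G₁ ω, G₂ ω) := hG₁m.prodMk hG₂m
  have hAm : Measurable fun ω => φ (U₁ ω, U₂ ω) := hφ.comp hUm
  have hUlaw : μ.map (fun ω => (U₁ ω, U₂ ω)) = (gaussianReal 0 1).prod (gaussianReal 0 1) := by
    rw [(indepFun_iff_map_prod_eq_prod_map_map hU₁m.aemeasurable hU₂m.aemeasurable).1 hUi,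
      hU₁.map_eq, hU₂.map_eq]
  have hGlaw : μ.map (fun ω => (G₁ ω, G₂ ω)) = (gaussianReal 0 1).prod (gaussianReal 0 1) := by
    rw [(indepFun_iff_map_prod_eq_prod_map_map hG₁m.aemeasurable hG₂m.aemeasurable).1 hGi,
      hG₁.map_eq, hG₂.map_eq]
  have hGBlaw : μ.map (fun ω => ((G₁ ω, G₂ ω), B ω)) =
      ((gaussianReal 0 1).prod (gaussianReal 0 1)).prod (μ.map B) := by
    rw [(indepFun_iff_map_prod_eq_prod_map_map hGm.aemeasurable hB.aemeasurable).1 hGB, hGlaw]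
  have hAlaw : μ.map (fun ω => φ (U₁ ω, U₂ ω)) =
      ((gaussianReal 0 1).prod (gaussianReal 0 1)).map φ := by
    rw [← hUlaw, Measure.map_map hφ hUm]; rfl
  have := Measure.isProbabilityMeasure_map (μ := μ) hB.aemeasurable
  -- The quadratic terms have mean zero, because the symbols and the normalised errors all have unit
  -- variance; only the constant survives integration.
  have hlog : ∀ ω, Real.log (r (φ (U₁ ω, U₂ ω), B ω)) = -Real.log σ₁ - Real.log σ₂ +
      ((U₁ ω ^ 2 + U₂ ω ^ 2) - (G₁ ω ^ 2 + G₂ ω ^ 2)) / 2 := by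
    intro ω
    have e1 : (U₁ ω - ζ₁ (B ω)) / σ₁ = G₁ ω := by rw [h₁]; field_simp; ring
    simp only [hr, hψφ]
    rw [Real.log_mul (gaussRatio_pos hσ₁).ne' (gaussRatio_pos hσ₂).ne', e1]
    nth_rewrite 1 [h₁ ω]
    nth_rewrite 1 [h₂ ω]
    rw [log_gaussRatio hσ₁, log_gaussRatio hσ₂, ← h₁, ← h₂]
    ring
  obtain ⟨iU₁, eU₁⟩ := integrable_sq_of_hasLaw hU₁
  obtain ⟨iU₂, eU₂⟩ := integrable_sq_of_hasLaw hU₂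
  obtain ⟨iG₁, eG₁⟩ := integrable_sq_of_hasLaw hG₁
  obtain ⟨iG₂, eG₂⟩ := integrable_sq_of_hasLaw hG₂
  have hint2 : Integrable (fun ω =>
      ((U₁ ω ^ 2 + U₂ ω ^ 2) - (G₁ ω ^ 2 + G₂ ω ^ 2)) / 2) μ :=
    ((iU₁.add iU₂).sub (iG₁.add iG₂)).div_const 2
  rw [mutualInfo_eq_of_density hAm hB hrm
    (fun x => mul_pos (gaussRatio_pos hσ₁) (gaussRatio_pos hσ₂))]
  · congr 1
    simp_rw [hlog]
    rw [integral_add (integrable_const _) hint2, integral_div,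
      integral_sub (f := fun ω => U₁ ω ^ 2 + U₂ ω ^ 2) (g := fun ω => G₁ ω ^ 2 + G₂ ω ^ 2)
        (iU₁.add iU₂) (iG₁.add iG₂),
      integral_add iU₁ iU₂, integral_add iG₁ iG₂, eU₁, eU₂, eG₁, eG₂]
    simp
  · refine Measure.ext_of_lintegral _ fun f hf => ?_
    rw [lintegral_withDensity_eq_lintegral_mul _ (by fun_prop) hf, hAlaw,
      lintegral_prod_symm _ (by fun_prop), lintegral_map hf (hAm.prodMk hB)]
    set h : (ℝ × ℝ) × F → ℝ≥0∞ := fun x =>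
      f (φ (ζ₁ x.2 + σ₁ * x.1.1, ζ₂ x.2 + κ * x.1.1 + σ₂ * x.1.2), x.2) with hh
    have hhm : Measurable h := by fun_prop
    have : ∀ ω, f (φ (U₁ ω, U₂ ω), B ω) = h ((G₁ ω, G₂ ω), B ω) := fun ω => by
      simp only [hh, ← h₁, ← h₂]
    simp_rw [this]
    rw [← lintegral_map (f := h) hhm (hGm.prodMk hB), hGBlaw,
      lintegral_prod_symm _ hhm.aemeasurable]
    refine lintegral_congr fun y => ?_
    rw [lintegral_map (by fun_prop) hφ, lintegral_prod _ (by fun_prop),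
      lintegral_prod _ (by fun_prop)]
    -- For fixed `B = y`, the triangular change of variables is undone one coordinate at a time: the
    -- second with the first held fixed, then the first.
    set J : ℝ → ℝ≥0∞ := fun u₁ => ∫⁻ u₂, ENNReal.ofReal
      (gaussRatio (ζ₂ y + κ * ((u₁ - ζ₁ y) / σ₁)) σ₂ u₂) * f (φ (u₁, u₂), y) ∂gaussianReal 0 1
      with hJ
    have hJm : Measurable J := by
      refine Measurable.lintegral_prod_right' (f := fun u : ℝ × ℝ => ENNReal.ofReal
        (gaussRatio (ζ₂ y + κ * ((u.1 - ζ₁ y) / σ₁)) σ₂ u.2) * f (φ (u.1, u.2), y)) ?_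
      fun_prop
    calc _ = ∫⁻ g, J (ζ₁ y + σ₁ * g) ∂gaussianReal 0 1 := by
          refine lintegral_congr fun g => ?_
          have : (ζ₁ y + σ₁ * g - ζ₁ y) / σ₁ = g := by field_simp; ring
          simp only [hh, hJ, this]
          exact lintegral_gaussian_affine hσ₂ _ (f := fun u => f (φ (ζ₁ y + σ₁ * g, u), y))
            (by fun_prop)
      _ = _ := by
          rw [lintegral_gaussian_affine hσ₁ _ hJm]
          refine lintegral_congr fun u₁ => ?_
          rw [hJ, ← lintegral_const_mul _ (by fun_prop)]
          refine lintegral_congr fun u₂ => ?_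
          simp only [hr, hψφ, Pi.mul_apply]
          rw [ENNReal.ofReal_mul (gaussRatio_pos hσ₁).le, mul_assoc]
  · simp_rw [hlog]
    exact (integrable_const _).add hint2

end MutualInfo

/-! ### The Gaussian space of messages and noise -/

section GaussianSpace

open scoped InnerProductSpace

variable {Ω : Type*} [MeasurableSpace Ω] {μ : Measure Ω} [IsProbabilityMeasure μ]
  {p : ℕ} {β : Fin p → ℂ} {Z : ℕ → Ω → ℝ} {U₁ U₂ : Ω → ℝ}

/-- The linear combinations of the initial symbols and the noise variables. -/
def gaussSpace (Z : ℕ → Ω → ℝ) (U₁ U₂ : Ω → ℝ) : Submodule ℝ (Ω → ℝ) :=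
  Submodule.span ℝ (Set.range Z) ⊔ Submodule.span ℝ {U₁, U₂}

omit [MeasurableSpace Ω] in
theorem noise_mem (n : ℕ) : Z n ∈ gaussSpace Z U₁ U₂ :=
  Submodule.mem_sup_left (Submodule.subset_span ⟨n, rfl⟩)

omit [MeasurableSpace Ω] in
theorem symbol_fst_mem : U₁ ∈ gaussSpace Z U₁ U₂ :=
  Submodule.mem_sup_right (Submodule.subset_span (by simp))

omit [MeasurableSpace Ω] in
theorem symbol_snd_mem : U₂ ∈ gaussSpace Z U₁ U₂ :=
  Submodule.mem_sup_right (Submodule.subset_span (by simp))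

omit [MeasurableSpace Ω] in
theorem message_add_two (a b : ℝ) (U₁ U₂ : Ω → ℝ) (n : ℕ) : message a b U₁ U₂ (n + 2) =
    a • message a b U₁ U₂ (n + 1) + b • message a b U₁ U₂ n := rfl

omit [MeasurableSpace Ω] in
theorem message_mem (a b : ℝ) (n : ℕ) : message a b U₁ U₂ n ∈ gaussSpace Z U₁ U₂ := by
  induction n using Nat.strong_induction_on with
  | _ n ih =>
    match n with
    | 0 => exact symbol_fst_mem
    | 1 => exact symbol_snd_mem
    | n + 2 =>
      rw [message_add_two]
      exact Submodule.add_mem _ (Submodule.smul_mem _ _ (ih _ (by omega)))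
        (Submodule.smul_mem _ _ (ih _ (by omega)))

variable (hZ : IsARNoise μ β Z) (hU : IsMessage μ Z U₁ U₂)
include hZ hU

omit [IsProbabilityMeasure μ] in
theorem hasGaussianLaw_of_mem {f : Ω → ℝ} (hf : f ∈ gaussSpace Z U₁ U₂) :
    HasGaussianLaw f μ := by
  obtain ⟨g, hg, h, hh, rfl⟩ := Submodule.mem_sup.1 hf
  obtain ⟨c, rfl⟩ := Finsupp.mem_span_range_iff_exists_finsupp.1 hg
  obtain ⟨d, e, rfl⟩ := Submodule.mem_span_pair.1 hh
  have h1 : HasGaussianLaw (c.sum fun i x => x • Z i) μ :=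
    (hZ.gaussian.smul c).hasGaussianLaw_sum (I := c.support)
  have h2 : HasGaussianLaw (d • U₁ + e • U₂) μ := by
    refine HasGaussianLaw.add (IndepFun.hasGaussianLaw (hU.law_fst.hasGaussianLaw.smul d)
      (hU.law_snd.hasGaussianLaw.smul e) ?_)
    exact hU.indep.comp (φ := fun x => d • x) (ψ := fun x => e • x) (by fun_prop) (by fun_prop)
  refine HasGaussianLaw.add (IndepFun.hasGaussianLaw h1 h2 ?_)
  have := hU.indep_noise.symm.comp (φ := fun x : ℕ → ℝ => c.sum fun i y => y • x i)
    (ψ := fun x : ℝ × ℝ => d • x.1 + e • x.2)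
    (by unfold Finsupp.sum; fun_prop) (by fun_prop)
  convert! this using 1
  ext ω
  simp [Finsupp.sum]

omit [IsProbabilityMeasure μ] in
theorem measurable_of_mem {f : Ω → ℝ} (hf : f ∈ gaussSpace Z U₁ U₂) : Measurable f := by
  obtain ⟨g, hg, h, hh, rfl⟩ := Submodule.mem_sup.1 hf
  obtain ⟨c, rfl⟩ := Finsupp.mem_span_range_iff_exists_finsupp.1 hg
  obtain ⟨d, e, rfl⟩ := Submodule.mem_span_pair.1 hh
  have h1 := hU.measurable_fst
  have h2 := hU.measurable_snd
  have h3 : Measurable (c.sum fun i x => x • Z i) := by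
    have : (c.sum fun i x => x • Z i) = fun ω => ∑ i ∈ c.support, c i • Z i ω := by
      ext ω; simp [Finsupp.sum]
    rw [this]
    exact Finset.measurable_sum _ fun i _ => (hZ.measurable i).const_smul (c i)
  exact h3.add ((h1.const_smul d).add (h2.const_smul e))

omit [IsProbabilityMeasure μ] in
theorem memLp_of_mem {f : Ω → ℝ} (hf : f ∈ gaussSpace Z U₁ U₂) : MemLp f 2 μ :=
  (hasGaussianLaw_of_mem hZ hU hf).memLp_two

omit [IsProbabilityMeasure μ] in
theorem integral_of_mem {f : Ω → ℝ} (hf : f ∈ gaussSpace Z U₁ U₂) : ∫ ω, f ω ∂μ = 0 := by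
  have key : gaussSpace Z U₁ U₂ = Submodule.span ℝ (Set.range Z ∪ {U₁, U₂}) :=
    (Submodule.span_union _ _).symm
  have hf' := hf
  rw [key] at hf'
  induction hf' using Submodule.span_induction with
  | mem f h =>
    rcases h with ⟨n, rfl⟩ | rfl | rfl
    · exact hZ.mean_zero n
    · rw [hU.law_fst.integral_eq]; simp
    · rw [hU.law_snd.integral_eq]; simp
  | zero => simp
  | add f g h1 h2 ih1 ih2 =>
    rw [← key] at h1 h2
    have := integral_add (hasGaussianLaw_of_mem hZ hU h1).integrable
      (hasGaussianLaw_of_mem hZ hU h2).integrable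
    simp only [Pi.add_apply]
    rw [this, ih1 h1, ih2 h2, add_zero]
  | smul c f h1 ih1 =>
    rw [← key] at h1
    simp only [Pi.smul_apply]
    rw [integral_smul, ih1 h1, smul_zero]

omit [IsProbabilityMeasure μ] in
-- Every linear functional of finitely many members is again a member of the space, hence Gaussian;
-- one-dimensional projections characterise joint Gaussianity. Orthogonality will therefore imply
-- independence.
theorem isGaussianProcess_of_mem {T : Type*} {X : T → Ω → ℝ}
    (hX : ∀ t, X t ∈ gaussSpace Z U₁ U₂) : IsGaussianProcess X μ := by
  refine ⟨fun I => ⟨isGaussian_of_isGaussian_map fun L => ?_⟩⟩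
  have hm : Measurable fun ω => I.restrict (X · ω) :=
    measurable_pi_lambda _ fun i => measurable_of_mem hZ hU (hX i)
  rw [Measure.map_map (by fun_prop) hm]
  refine (hasGaussianLaw_of_mem hZ hU ?_).isGaussian_map
  classical
  have : (L ∘ fun ω => I.restrict (X · ω)) = ∑ i : I, L (Pi.single i 1) • X i := by
    ext ω
    have hL := L.toLinearMap.pi_apply_eq_sum_univ (I.restrict (X · ω))
    simp only [ContinuousLinearMap.coe_coe] at hL
    rw [Function.comp_apply, hL, Finset.sum_apply]
    refine Finset.sum_congr rfl fun i _ => ?_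
    rw [smul_eq_mul, Pi.smul_apply, smul_eq_mul, mul_comm]
    congr 2
    ext j
    simp [Pi.single_apply, eq_comm]
  rw [this]
  exact Submodule.sum_mem _ fun i _ => Submodule.smul_mem _ _ (hX i)

theorem covariance_of_mem {f g : Ω → ℝ} (hf : f ∈ gaussSpace Z U₁ U₂)
    (hg : g ∈ gaussSpace Z U₁ U₂) : cov[f, g; μ] = ∫ ω, f ω * g ω ∂μ := by
  rw [covariance_eq_sub (memLp_of_mem hZ hU hf) (memLp_of_mem hZ hU hg), integral_of_mem hZ hU hf,
    zero_mul, sub_zero]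
  rfl

theorem indepFun_of_mem {S T : Type*} {X : S → Ω → ℝ} {Y : T → Ω → ℝ}
    (hX : ∀ s, X s ∈ gaussSpace Z U₁ U₂) (hY : ∀ t, Y t ∈ gaussSpace Z U₁ U₂)
    (h : ∀ s t, ∫ ω, X s ω * Y t ω ∂μ = 0) :
    IndepFun (fun ω s => X s ω) (fun ω t => Y t ω) μ := by
  refine IsGaussianProcess.indepFun_of_covariance_eq_zero
    (isGaussianProcess_of_mem hZ hU (X := Sum.elim X Y) ?_)
    (fun s => (measurable_of_mem hZ hU (hX s)).aemeasurable)
    (fun t => (measurable_of_mem hZ hU (hY t)).aemeasurable) fun s t => ?_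
  · rintro (s | t)
    · exact hX s
    · exact hY t
  · rw [covariance_of_mem hZ hU (hX s) (hY t), h]

omit [IsProbabilityMeasure μ] in
theorem hasLaw_of_mem {f : Ω → ℝ} (hf : f ∈ gaussSpace Z U₁ U₂) (h : ∫ ω, f ω ^ 2 ∂μ = 1) :
    HasLaw f (gaussianReal 0 1) μ := by
  refine ⟨(measurable_of_mem hZ hU hf).aemeasurable, ?_⟩
  have h0 := integral_of_mem hZ hU hf
  rw [(hasGaussianLaw_of_mem hZ hU hf).map_eq_gaussianReal, h0,
    variance_of_integral_eq_zero (measurable_of_mem hZ hU hf).aemeasurable h0]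
  simp [h]

/-- The embedding of the Gaussian space into `L²`. -/
noncomputable def toL2 : gaussSpace Z U₁ U₂ →ₗ[ℝ] Lp ℝ 2 μ where
  toFun f := (memLp_of_mem hZ hU f.2).toLp f.1
  map_add' _ _ := rfl
  map_smul' _ _ := rfl

omit [IsProbabilityMeasure μ] in
theorem inner_toL2 (f g : gaussSpace Z U₁ U₂) :
    ⟪toL2 hZ hU f, toL2 hZ hU g⟫_ℝ = ∫ ω, f.1 ω * g.1 ω ∂μ := by
  rw [L2.inner_def]
  refine integral_congr_ae ?_
  filter_upwards [(memLp_of_mem hZ hU f.2).coeFn_toLp, (memLp_of_mem hZ hU g.2).coeFn_toLp]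
    with ω h1 h2
  have e1 : (toL2 hZ hU f : Ω → ℝ) ω = f.1 ω := h1
  have e2 : (toL2 hZ hU g : Ω → ℝ) ω = g.1 ω := h2
  rw [e1, e2]
  simp [mul_comm]

omit [IsProbabilityMeasure μ] in
theorem integral_symbol_noise {f : Ω → ℝ} (hf : f = U₁ ∨ f = U₂) (j : ℕ) :
    ∫ ω, f ω * Z j ω ∂μ = 0 := by
  have hi : IndepFun f (Z j) μ := by
    rcases hf with rfl | rfl
    · exact hU.indep_noise.comp (φ := Prod.fst) (ψ := fun x : ℕ → ℝ => x j) (by fun_prop)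
        (by fun_prop)
    · exact hU.indep_noise.comp (φ := Prod.snd) (ψ := fun x : ℕ → ℝ => x j) (by fun_prop)
        (by fun_prop)
  have hm : Measurable f := by
    rcases hf with rfl | rfl
    · exact hU.measurable_fst
    · exact hU.measurable_snd
  have := hi.integral_mul_eq_mul_integral hm.aestronglyMeasurable
    (hZ.measurable j).aestronglyMeasurable
  simp only [hZ.mean_zero, mul_zero] at this
  exact this

/-- The messages, as elements of `L²`. -/
noncomputable def messageL2 (a b : ℝ) (n : ℕ) : Lp ℝ 2 μ :=
  toL2 hZ hU ⟨message a b U₁ U₂ n, message_mem a b n⟩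

/-- The noise, as elements of `L²`. -/
noncomputable def noiseL2 (n : ℕ) : Lp ℝ 2 μ := toL2 hZ hU ⟨Z n, noise_mem n⟩

omit [IsProbabilityMeasure μ] in
theorem isLinearModel (hβ : IsARParam β) (a b : ℝ) :
    IsLinearModel a b p (fun k => ((arPoly β).coeff k).re) (messageL2 hZ hU a b)
      (noiseL2 hZ hU) where
  rec_eq n := by
    rw [messageL2, messageL2, messageL2, ← map_smul, ← map_smul, ← map_add]
    rfl
  inner_zero_zero := by
    rw [messageL2, inner_toL2]
    have := (integrable_sq_of_hasLaw hU.law_fst).2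
    simp only [sq] at this
    exact this
  inner_zero_one := by
    rw [messageL2, messageL2, inner_toL2]
    have := hU.indep.integral_mul_eq_mul_integral hU.measurable_fst.aestronglyMeasurable
      hU.measurable_snd.aestronglyMeasurable
    rw [integral_of_mem hZ hU symbol_fst_mem, zero_mul] at this
    exact this
  inner_one_one := by
    rw [messageL2, inner_toL2]
    have := (integrable_sq_of_hasLaw hU.law_snd).2
    simp only [sq] at this
    exact this
  inner_zero_noise j := by
    rw [messageL2, noiseL2, inner_toL2]
    exact integral_symbol_noise hZ hU (Or.inl rfl) j
  inner_one_noise j := by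
    rw [messageL2, noiseL2, inner_toL2]
    exact integral_symbol_noise hZ hU (Or.inr rfl) j
  stationary i j := by
    simp only [noiseL2, inner_toL2]
    exact hZ.stationary i j
  filter_zero := by rw [arPoly_coeff_zero, Complex.one_re]
  white n k hn hk := by
    simp only [noiseL2, inner_toL2]
    exact hZ.white hβ hn hk

omit [IsProbabilityMeasure μ] in
/-- Least squares estimation of an element of the Gaussian space by the first `n` noisy
messages. -/
theorem exists_resid (a b : ℝ) {f : Ω → ℝ} (hf : f ∈ gaussSpace Z U₁ U₂) (n : ℕ) :
    ∃ (c : Fin n → ℝ) (R : gaussSpace Z U₁ U₂),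
      (∀ ω, f ω = ∑ j, c j * (message a b U₁ U₂ j ω + Z j ω) + R.1 ω) ∧
      toL2 hZ hU R = resid (fun j => messageL2 hZ hU a b j + noiseL2 hZ hU j) n
        (toL2 hZ hU ⟨f, hf⟩) ∧
      ∀ j : Fin n, ∫ ω, R.1 ω * (message a b U₁ U₂ j ω + Z j ω) ∂μ = 0 := by
  have hmem := sub_resid_mem (fun j => messageL2 hZ hU a b j + noiseL2 hZ hU j) n
    (toL2 hZ hU ⟨f, hf⟩)
  have himg : (fun j => messageL2 hZ hU a b j + noiseL2 hZ hU j) '' Set.Iio n =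
      Set.range (fun j : Fin n => messageL2 hZ hU a b j + noiseL2 hZ hU j) := by
    ext x
    constructor
    · rintro ⟨j, hj, rfl⟩; exact ⟨⟨j, hj⟩, rfl⟩
    · rintro ⟨j, rfl⟩; exact ⟨j, j.2, rfl⟩
  rw [himg, Submodule.mem_span_range_iff_exists_fun] at hmem
  obtain ⟨c, hc⟩ := hmem
  set Y : ℕ → gaussSpace Z U₁ U₂ := fun j =>
    ⟨message a b U₁ U₂ j, message_mem a b j⟩ + ⟨Z j, noise_mem j⟩ with hY
  have hYL : ∀ j, toL2 hZ hU (Y j) = messageL2 hZ hU a b j + noiseL2 hZ hU j := fun j =>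
    map_add _ _ _
  set R : gaussSpace Z U₁ U₂ := ⟨f, hf⟩ - ∑ j, c j • Y j with hR
  have hRL : toL2 hZ hU R = resid (fun j => messageL2 hZ hU a b j + noiseL2 hZ hU j) n
      (toL2 hZ hU ⟨f, hf⟩) := by
    rw [hR, map_sub, map_sum]
    simp only [map_smul, hYL]
    rw [hc, sub_sub_cancel]
  refine ⟨c, R, fun ω => ?_, hRL, fun j => ?_⟩
  · have : R.1 = f - ∑ j, c j • (Y j).1 := by simp [hR]
    rw [this]
    simp [hY, mul_add]
  · have h1 := inner_toL2 hZ hU R (Y j)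
    rw [hRL, hYL, real_inner_comm] at h1
    rw [inner_resid_of_lt (fun j => messageL2 hZ hU a b j + noiseL2 hZ hU j) j.2] at h1
    exact h1.symm

end GaussianSpace

/-! ### The feedback scheme -/

section Scheme

variable {Ω : Type*} [mΩ : MeasurableSpace Ω] {μ : Measure Ω}

/-- The information of the first `n` outputs of a sequence. -/
abbrev history (Y : ℕ → Ω → ℝ) (n : ℕ) : MeasurableSpace Ω :=
  ⨆ j : Fin n, MeasurableSpace.comap (Y j.1) inferInstance

omit mΩ in
theorem history_mono (Y : ℕ → Ω → ℝ) {m n : ℕ} (h : m ≤ n) : history Y m ≤ history Y n :=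
  iSup_le fun j => le_iSup (fun j : Fin n => MeasurableSpace.comap (Y j.1) inferInstance)
    (Fin.castLE h j)

omit mΩ in
theorem measurable_history (Y : ℕ → Ω → ℝ) {j n : ℕ} (h : j < n) :
    Measurable[history Y n] (Y j) :=
  measurable_iff_comap_le.2
    (le_iSup (fun j : Fin n => MeasurableSpace.comap (Y j.1) inferInstance) ⟨j, h⟩)

omit mΩ in
theorem history_eq_comap (Y : ℕ → Ω → ℝ) (n : ℕ) :
    history Y n = MeasurableSpace.comap (fun ω (j : Fin n) => Y j ω) MeasurableSpace.pi := by
  rw [MeasurableSpace.pi, MeasurableSpace.comap_iSup]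
  simp only [MeasurableSpace.comap_comp]
  rfl

theorem input_of_lt (V Z : ℕ → Ω → ℝ) {n : ℕ} (hn : n < 2) : input μ V Z n = V n := by
  ext ω; simp [input, hn]

theorem input_of_le (V Z : ℕ → Ω → ℝ) {n : ℕ} (hn : 2 ≤ n) :
    input μ V Z n = V n - μ[V n | history (output μ V Z) n] := by
  ext ω
  simp only [input, not_lt.2 hn, if_false, Pi.sub_apply]

theorem output_eq_add (V Z : ℕ → Ω → ℝ) (n : ℕ) :
    output μ V Z n = fun ω => input μ V Z n ω + Z n ω := by
  ext ω; exact output_eq μ V Z n ω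

/-- The subtracted conditional expectation is measurable for the earlier outputs, so it can be added
or removed without changing the information. By induction feedback is equivalent to observing `V +
Z`. -/
theorem history_output (V Z : ℕ → Ω → ℝ) (n : ℕ) :
    history (output μ V Z) n = history (fun j ω => V j ω + Z j ω) n := by
  induction n using Nat.strong_induction_on with
  | _ n ih =>
    refine le_antisymm (iSup_le fun j => measurable_iff_comap_le.1 ?_)
      (iSup_le fun j => measurable_iff_comap_le.1 ?_)
    · rw [output_eq_add]
      have hj := measurable_history (fun j ω => V j ω + Z j ω) j.2
      rcases lt_or_ge j.1 2 with h | h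
      · rw [input_of_lt V Z h]; exact hj
      · have hc : Measurable[history (fun j ω => V j ω + Z j ω) n]
            (μ[V j | history (output μ V Z) j]) := by
          rw [ih j j.2]
          exact stronglyMeasurable_condExp.measurable.mono (history_mono _ j.2.le) le_rfl
        rw [input_of_le V Z h]
        convert hj.sub hc using 1
        ext ω
        simp only [Pi.sub_apply]
        ring
    · have hj := measurable_history (output μ V Z) j.2
      rw [output_eq_add] at hj
      rcases lt_or_ge j.1 2 with h | h
      · rw [input_of_lt V Z h] at hj; exact hj
      · have hc : Measurable[history (output μ V Z) n] (μ[V j | history (output μ V Z) j]) :=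
          stronglyMeasurable_condExp.measurable.mono (history_mono _ j.2.le) le_rfl
        rw [input_of_le V Z h] at hj
        convert hj.add hc using 1
        ext ω
        simp only [Pi.sub_apply, Pi.add_apply]
        ring

omit mΩ in
theorem message_eq_apply (a b : ℝ) (U₁ U₂ : Ω → ℝ) (n : ℕ) (ω : Ω) :
    message a b U₁ U₂ n ω = message a b (Prod.fst : ℝ × ℝ → ℝ) Prod.snd n (U₁ ω, U₂ ω) := by
  induction n using Nat.strong_induction_on with
  | _ n ih =>
    match n with
    | 0 => rfl
    | 1 => rfl
    | n + 2 => simp only [message, ih (n + 1) (by omega), ih n (by omega)]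

omit mΩ in
theorem measurable_message {Ω : Type*} [MeasurableSpace Ω] (a b : ℝ) {U₁ U₂ : Ω → ℝ}
    (h₁ : Measurable U₁) (h₂ : Measurable U₂) (n : ℕ) : Measurable (message a b U₁ U₂ n) := by
  induction n using Nat.strong_induction_on with
  | _ n ih =>
    match n with
    | 0 => exact h₁
    | 1 => exact h₂
    | n + 2 =>
      rw [message_add_two]
      exact ((ih _ (by omega)).const_smul a).add ((ih _ (by omega)).const_smul b)

variable [IsProbabilityMeasure μ] {p : ℕ} {β : Fin p → ℂ} {Z : ℕ → Ω → ℝ} {U₁ U₂ : Ω → ℝ}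
  (hZ : IsARNoise μ β Z) (hU : IsMessage μ Z U₁ U₂)
include hZ hU

omit [IsProbabilityMeasure μ] in
theorem history_le (a b : ℝ) (n : ℕ) :
    history (fun j ω => message a b U₁ U₂ j ω + Z j ω) n ≤ mΩ :=
  iSup_le fun j => measurable_iff_comap_le.1
    ((measurable_message a b hU.measurable_fst hU.measurable_snd j).add (hZ.measurable j))

theorem indep_history (a b : ℝ) {T : Type*} {X : T → Ω → ℝ}
    (hX : ∀ t, X t ∈ gaussSpace Z U₁ U₂) {n : ℕ}
    (h : ∀ t (j : Fin n), ∫ ω, X t ω * (message a b U₁ U₂ j ω + Z j ω) ∂μ = 0) :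
    Indep (MeasurableSpace.comap (fun ω t => X t ω) MeasurableSpace.pi)
      (history (fun j ω => message a b U₁ U₂ j ω + Z j ω) n) μ := by
  rw [history_eq_comap]
  exact indepFun_of_mem hZ hU (Y := fun (j : Fin n) ω => message a b U₁ U₂ j ω + Z j ω) hX
    (fun j => Submodule.add_mem _ (message_mem a b j) (noise_mem j)) h

/-- The least squares error is orthogonal to the observations, hence independent of them, and
centred. The linear estimate is thus the conditional expectation, and the input is almost surely the
error. -/
theorem lintegral_input_sq (a b : ℝ) {n : ℕ} (hn : 2 ≤ n) :
    ∫⁻ ω, ENNReal.ofReal (input μ (message a b U₁ U₂) Z n ω ^ 2) ∂μ =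
      ENNReal.ofReal (‖resid (fun j => messageL2 hZ hU a b j + noiseL2 hZ hU j) n
        (messageL2 hZ hU a b n)‖ ^ 2) := by
  obtain ⟨c, R, hf, hR, horth⟩ := exists_resid hZ hU a b (message_mem (Z := Z) a b n) n
  have hRm := memLp_of_mem hZ hU R.2
  set S : Ω → ℝ := fun ω => ∑ j, c j * (message a b U₁ U₂ j ω + Z j ω) with hS
  have hSR : message a b U₁ U₂ n = S + R.1 := funext hf
  have hle := history_le hZ hU a b n
  have hSm : StronglyMeasurable[history (fun j ω => message a b U₁ U₂ j ω + Z j ω) n] S := by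
    refine Measurable.stronglyMeasurable ?_
    refine Finset.measurable_sum _ fun j _ => Measurable.const_mul ?_ _
    exact measurable_history (fun j ω => message a b U₁ U₂ j ω + Z j ω) j.2
  have hRi : Integrable R.1 μ := (hasGaussianLaw_of_mem hZ hU R.2).integrable
  have hSi : Integrable S μ := by
    have : S = message a b U₁ U₂ n - R.1 := by rw [hSR]; simp
    rw [this]
    exact (hasGaussianLaw_of_mem hZ hU (message_mem a b n)).integrable.sub hRi
  have hind : Indep (MeasurableSpace.comap R.1 inferInstance)
      (history (fun j ω => message a b U₁ U₂ j ω + Z j ω) n) μ := by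
    refine indep_of_indep_of_le_left (indep_history hZ hU a b (T := Unit) (X := fun _ => R.1)
      (fun _ => R.2) (fun _ => horth)) ?_
    refine measurable_iff_comap_le.1 ?_
    exact (measurable_pi_apply ()).comp (comap_measurable fun ω (_ : Unit) => R.1 ω)
  have hRce : μ[R.1 | history (fun j ω => message a b U₁ U₂ j ω + Z j ω) n] =ᵐ[μ] fun _ => 0 := by
    have := condExp_indep_eq (measurable_of_mem hZ hU R.2).comap_le hle
      (comap_measurable R.1).stronglyMeasurable hind
    rwa [integral_of_mem hZ hU R.2] at this
  have hce : μ[message a b U₁ U₂ n | history (output μ (message a b U₁ U₂) Z) n] =ᵐ[μ] S := by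
    rw [history_output, hSR]
    filter_upwards [condExp_add hSi hRi (history (fun j ω => message a b U₁ U₂ j ω + Z j ω) n),
      hRce] with ω h1 h2
    rw [h1, Pi.add_apply, h2, condExp_of_stronglyMeasurable hle hSm hSi, add_zero]
  have hX : input μ (message a b U₁ U₂) Z n =ᵐ[μ] R.1 := by
    rw [input_of_le _ _ hn]
    filter_upwards [hce] with ω h1
    rw [Pi.sub_apply, h1, hSR]
    simp
  have hX2 : (fun ω => ENNReal.ofReal (input μ (message a b U₁ U₂) Z n ω ^ 2)) =ᵐ[μ]
      fun ω => ENNReal.ofReal (R.1 ω ^ 2) := by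
    filter_upwards [hX] with ω h1
    rw [h1]
  rw [lintegral_congr_ae hX2, ← ofReal_integral_eq_lintegral_ofReal hRm.integrable_sq
    (ae_of_all _ fun ω => sq_nonneg _)]
  congr 1
  have h2 := inner_toL2 hZ hU R R
  rw [real_inner_self_eq_norm_sq, hR] at h2
  rw [messageL2, h2]
  simp only [sq]

theorem lintegral_input_sq_ne_top (a b : ℝ) (n : ℕ) :
    ∫⁻ ω, ENNReal.ofReal (input μ (message a b U₁ U₂) Z n ω ^ 2) ∂μ ≠ ∞ := by
  rcases lt_or_ge n 2 with hn | hn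
  · rw [input_of_lt _ _ hn, ← ofReal_integral_eq_lintegral_ofReal
      (memLp_of_mem hZ hU (message_mem a b n)).integrable_sq (ae_of_all _ fun ω => sq_nonneg _)]
    exact ENNReal.ofReal_ne_top
  · rw [lintegral_input_sq hZ hU a b hn]
    exact ENNReal.ofReal_ne_top

/-- The individual powers converge, so their Cesàro means have the same limit and the upper limit is
attained as a limit. -/
theorem asympPower_eq (hβ : IsARParam β) {a b : ℝ} {x y : ℂ} (hr : AreCharRoots a b x y)
    (hx : 1 < ‖x‖) (hy : 1 < ‖y‖) :
    asympPower μ (input μ (message a b U₁ U₂) Z) = ENNReal.ofReal (power β x y) := by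
  set t : ℕ → ℝ := fun n =>
    (∫⁻ ω, ENNReal.ofReal (input μ (message a b U₁ U₂) Z n ω ^ 2) ∂μ).toReal with ht
  have hlim : Tendsto t atTop (𝓝 (power β x y)) := by
    refine ((isLinearModel hZ hU hβ a b).tendsto_errCov hβ hr hx hy).1.congr' ?_
    filter_upwards [eventually_ge_atTop 2] with n hn
    rw [ht]
    simp only []
    rw [lintegral_input_sq hZ hU a b hn, ENNReal.toReal_ofReal (sq_nonneg _)]
  have hc := ENNReal.tendsto_ofReal hlim.cesaro
  refine Tendsto.limsup_eq (hc.congr' ?_)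
  filter_upwards [eventually_gt_atTop 0] with n hn
  have hn' : (0 : ℝ) < n := by exact_mod_cast hn
  rw [mul_comm, ← div_eq_mul_inv, ENNReal.ofReal_div_of_pos hn', ENNReal.ofReal_natCast,
    ENNReal.ofReal_sum_of_nonneg fun i _ => ENNReal.toReal_nonneg]
  congr 1
  exact Finset.sum_congr rfl fun i _ =>
    ENNReal.ofReal_toReal (lintegral_input_sq_ne_top hZ hU a b i)

/-- Gram–Schmidt on the estimation errors of the two symbols gives independent standard normals `G₁,
G₂`, independent of the outputs. The scales satisfy `σ₁² σ₂² = d`, the Gram determinant, so the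
information is `-log (σ₁ σ₂) = -(1/2) log d`. -/
theorem mutualInfo_eq (a b : ℝ) {n : ℕ} (hn : 2 ≤ n)
    (hg : 0 < gramDet (resid (fun j => messageL2 hZ hU a b j + noiseL2 hZ hU j) n
      (messageL2 hZ hU a b 0)) (resid (fun j => messageL2 hZ hU a b j + noiseL2 hZ hU j) n
      (messageL2 hZ hU a b 1))) :
    mutualInfo μ (fun ω (i : Fin n) => message a b U₁ U₂ i ω)
      (fun ω (i : Fin n) => output μ (message a b U₁ U₂) Z i ω) =
    ENNReal.ofReal (-(1 / 2) * Real.log (gramDet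
      (resid (fun j => messageL2 hZ hU a b j + noiseL2 hZ hU j) n (messageL2 hZ hU a b 0))
      (resid (fun j => messageL2 hZ hU a b j + noiseL2 hZ hU j) n (messageL2 hZ hU a b 1)))) := by
  obtain ⟨c₁, R₁, hf₁, hR₁, ho₁⟩ := exists_resid hZ hU a b (symbol_fst_mem (Z := Z)) n
  obtain ⟨c₂, R₂, hf₂, hR₂, ho₂⟩ := exists_resid hZ hU a b (symbol_snd_mem (Z := Z)) n
  have e₁ : resid (fun j => messageL2 hZ hU a b j + noiseL2 hZ hU j) n (messageL2 hZ hU a b 0) =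
    toL2 hZ hU R₁ := hR₁.symm
  have e₂ : resid (fun j => messageL2 hZ hU a b j + noiseL2 hZ hU j) n (messageL2 hZ hU a b 1) =
    toL2 hZ hU R₂ := hR₂.symm
  rw [e₁, e₂] at hg ⊢
  rw [gramDet, inner_toL2, inner_toL2, inner_toL2] at hg ⊢
  set s₁₁ := ∫ ω, R₁.1 ω * R₁.1 ω ∂μ with hs₁₁
  set s₁₂ := ∫ ω, R₁.1 ω * R₂.1 ω ∂μ with hs₁₂
  set s₂₂ := ∫ ω, R₂.1 ω * R₂.1 ω ∂μ with hs₂₂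
  have hs0 : 0 ≤ s₁₁ := integral_nonneg fun ω => mul_self_nonneg _
  have hs1 : 0 < s₁₁ := lt_of_le_of_ne hs0 fun h => by
    rw [← h] at hg
    nlinarith [sq_nonneg s₁₂]
  set d := s₁₁ * s₂₂ - s₁₂ ^ 2 with hd
  have hds : 0 < d / s₁₁ := div_pos hg hs1
  set σ₁ := Real.sqrt s₁₁ with hσ₁
  set σ₂ := Real.sqrt (d / s₁₁) with hσ₂
  have hσ₁0 : 0 < σ₁ := Real.sqrt_pos.2 hs1
  have hσ₂0 : 0 < σ₂ := Real.sqrt_pos.2 hds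
  have hσ₁2 : σ₁ ^ 2 = s₁₁ := Real.sq_sqrt hs0
  have hσ₂2 : σ₂ ^ 2 = d / s₁₁ := Real.sq_sqrt hds.le
  set G₁ : gaussSpace Z U₁ U₂ := σ₁⁻¹ • R₁ with hG₁
  set G₂ : gaussSpace Z U₁ U₂ := σ₂⁻¹ • (R₂ - (s₁₂ / s₁₁) • R₁) with hG₂
  have i₁₁ : Integrable (fun ω => R₁.1 ω * R₁.1 ω) μ :=
    (memLp_of_mem hZ hU R₁.2).integrable_mul (memLp_of_mem hZ hU R₁.2)
  have i₁₂ : Integrable (fun ω => R₁.1 ω * R₂.1 ω) μ :=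
    (memLp_of_mem hZ hU R₁.2).integrable_mul (memLp_of_mem hZ hU R₂.2)
  have i₂₂ : Integrable (fun ω => R₂.1 ω * R₂.1 ω) μ :=
    (memLp_of_mem hZ hU R₂.2).integrable_mul (memLp_of_mem hZ hU R₂.2)
  have g₁ : ∀ ω, G₁.1 ω = σ₁⁻¹ * R₁.1 ω := fun ω => rfl
  have g₂ : ∀ ω, G₂.1 ω = σ₂⁻¹ * (R₂.1 ω - s₁₂ / s₁₁ * R₁.1 ω) := fun ω => rfl
  have v₁ : ∫ ω, G₁.1 ω ^ 2 ∂μ = 1 := by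
    have : ∀ ω, G₁.1 ω ^ 2 = (σ₁ ^ 2)⁻¹ * (R₁.1 ω * R₁.1 ω) := fun ω => by rw [g₁]; ring
    simp_rw [this]
    rw [integral_const_mul, hσ₁2, inv_mul_cancel₀ hs1.ne']
  have v₂ : ∫ ω, G₂.1 ω ^ 2 ∂μ = 1 := by
    have : ∀ ω, G₂.1 ω ^ 2 = (σ₂ ^ 2)⁻¹ * (R₂.1 ω * R₂.1 ω - 2 * (s₁₂ / s₁₁) * (R₁.1 ω * R₂.1 ω) +
      (s₁₂ / s₁₁) ^ 2 * (R₁.1 ω * R₁.1 ω)) := fun ω => by rw [g₂]; ring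
    simp_rw [this]
    rw [integral_const_mul,
      integral_add (f := fun ω => R₂.1 ω * R₂.1 ω - 2 * (s₁₂ / s₁₁) * (R₁.1 ω * R₂.1 ω))
        (g := fun ω => (s₁₂ / s₁₁) ^ 2 * (R₁.1 ω * R₁.1 ω))
        (i₂₂.sub (i₁₂.const_mul _)) (i₁₁.const_mul _),
      integral_sub i₂₂ (i₁₂.const_mul _), integral_const_mul, integral_const_mul, ← hs₁₁, ← hs₁₂,
      ← hs₂₂, hσ₂2]
    have : s₂₂ - 2 * (s₁₂ / s₁₁) * s₁₂ + (s₁₂ / s₁₁) ^ 2 * s₁₁ = d / s₁₁ := by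
      rw [hd]; field_simp; ring
    rw [this, inv_mul_cancel₀ hds.ne']
  have v₁₂ : ∫ ω, G₁.1 ω * G₂.1 ω ∂μ = 0 := by
    have : ∀ ω, G₁.1 ω * G₂.1 ω = (σ₁⁻¹ * σ₂⁻¹) * (R₁.1 ω * R₂.1 ω -
      (s₁₂ / s₁₁) * (R₁.1 ω * R₁.1 ω)) := fun ω => by rw [g₁, g₂]; ring
    simp_rw [this]
    rw [integral_const_mul, integral_sub i₁₂ (i₁₁.const_mul _), integral_const_mul, ← hs₁₁,
      ← hs₁₂, div_mul_cancel₀ _ hs1.ne', sub_self, mul_zero]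
  have hYm : ∀ j, MemLp (fun ω => message a b U₁ U₂ j ω + Z j ω) 2 μ := fun j =>
    memLp_of_mem hZ hU (Submodule.add_mem _ (message_mem a b j) (noise_mem j))
  have o₁ : ∀ j : Fin n, ∫ ω, G₁.1 ω * (message a b U₁ U₂ j ω + Z j ω) ∂μ = 0 := fun j => by
    simp_rw [g₁, mul_assoc]
    rw [integral_const_mul, ho₁, mul_zero]
  have o₂ : ∀ j : Fin n, ∫ ω, G₂.1 ω * (message a b U₁ U₂ j ω + Z j ω) ∂μ = 0 := fun j => by
    have : ∀ ω, G₂.1 ω * (message a b U₁ U₂ j ω + Z j ω) =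
        σ₂⁻¹ * (R₂.1 ω * (message a b U₁ U₂ j ω + Z j ω) -
          s₁₂ / s₁₁ * (R₁.1 ω * (message a b U₁ U₂ j ω + Z j ω))) := fun ω => by rw [g₂]; ring
    simp_rw [this]
    have j₁ : Integrable (fun ω => R₁.1 ω * (message a b U₁ U₂ j ω + Z j ω)) μ :=
      (memLp_of_mem hZ hU R₁.2).integrable_mul (hYm j)
    have j₂ : Integrable (fun ω => R₂.1 ω * (message a b U₁ U₂ j ω + Z j ω)) μ :=
      (memLp_of_mem hZ hU R₂.2).integrable_mul (hYm j)
    rw [integral_const_mul, integral_sub j₂ (j₁.const_mul _), integral_const_mul, ho₁, ho₂,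
      mul_zero, sub_zero, mul_zero]
  have hhist := history_output (μ := μ) (message a b U₁ U₂) Z n
  have hcomap := history_eq_comap (output μ (message a b U₁ U₂) Z) n
  set B : Ω → Fin n → ℝ := fun ω i => output μ (message a b U₁ U₂) Z i ω with hB
  have hBm : Measurable B := by
    rw [measurable_iff_comap_le, ← hcomap, hhist]
    exact history_le hZ hU a b n
  -- The estimates are linear in `V + Z`, not in the outputs; the Doob–Dynkin factorisation makes
  -- them measurable functions of the output block.
  have hfactor : ∀ c : Fin n → ℝ, ∃ ζ : (Fin n → ℝ) → ℝ, Measurable ζ ∧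
      (fun ω => ∑ j, c j * (message a b U₁ U₂ j ω + Z j ω)) = ζ ∘ B := by
    intro c
    refine Measurable.exists_eq_measurable_comp ?_
    rw [← hcomap, hhist]
    refine Finset.measurable_sum _ fun j _ => Measurable.const_mul ?_ _
    exact measurable_history (fun j ω => message a b U₁ U₂ j ω + Z j ω) j.2
  obtain ⟨ζ₁, hζ₁, hζ₁'⟩ := hfactor c₁
  obtain ⟨ζ₂, hζ₂, hζ₂'⟩ := hfactor c₂
  set G : Fin 2 → Ω → ℝ := ![G₁.1, G₂.1] with hG
  have hGB : IndepFun (fun ω => (G₁.1 ω, G₂.1 ω)) B μ := by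
    have hi := indep_history hZ hU a b (X := G) (n := n)
      (fun t => by fin_cases t; exacts [G₁.2, G₂.2])
      (fun t j => by fin_cases t; exacts [o₁ j, o₂ j])
    rw [← hhist, hcomap] at hi
    exact IndepFun.comp (f := fun ω t => G t ω) (g := B) (φ := fun x => (x 0, x 1)) (ψ := id)
      hi (by fun_prop) measurable_id
  have hGi : IndepFun G₁.1 G₂.1 μ := by
    have hi := indepFun_of_mem hZ hU (X := fun _ : Unit => G₁.1) (Y := fun _ : Unit => G₂.1)
      (fun _ => G₁.2) (fun _ => G₂.2) (fun _ _ => v₁₂)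
    exact hi.comp (φ := fun x : Unit → ℝ => x ()) (ψ := fun x : Unit → ℝ => x ())
      (measurable_pi_apply ()) (measurable_pi_apply ())
  have hmi := mutualInfo_gaussian (μ := μ) hU.measurable_fst hU.measurable_snd hU.law_fst
    hU.law_snd hU.indep
    (φ := fun u (i : Fin n) => message a b (Prod.fst : ℝ × ℝ → ℝ) Prod.snd i u)
    (measurable_pi_lambda _ fun i => measurable_message a b measurable_fst measurable_snd i)
    (ψ := fun v => (v ⟨0, by omega⟩, v ⟨1, by omega⟩)) (by fun_prop) (fun u => rfl)
    hBm hζ₁ hζ₂ (measurable_of_mem hZ hU G₁.2) (measurable_of_mem hZ hU G₂.2)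
    (hasLaw_of_mem hZ hU G₁.2 v₁) (hasLaw_of_mem hZ hU G₂.2 v₂) hGi hGB
    (κ := s₁₂ / σ₁) hσ₁0 hσ₂0 (fun ω => ?_) (fun ω => ?_)
  · have hV : (fun ω (i : Fin n) => message a b U₁ U₂ i ω) = fun ω (i : Fin n) =>
        message a b (Prod.fst : ℝ × ℝ → ℝ) Prod.snd i (U₁ ω, U₂ ω) := by
      ext ω i; exact message_eq_apply a b U₁ U₂ i ω
    rw [hV, hmi]
    congr 1
    rw [hσ₁, hσ₂, Real.log_sqrt hs0, Real.log_sqrt hds.le, Real.log_div hg.ne' hs1.ne']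
    ring
  · rw [hf₁ ω, g₁, mul_inv_cancel_left₀ hσ₁0.ne']
    congr 1
    exact congrFun hζ₁' ω
  · rw [hf₂ ω, g₁, g₂, mul_inv_cancel_left₀ hσ₂0.ne', congrFun hζ₂' ω, Function.comp_apply,
      ← hσ₁2]
    field_simp
    ring

theorem hasMutualInfoRate (hβ : IsARParam β) {a b : ℝ} {x y : ℂ} (hr : AreCharRoots a b x y)
    (hx : 1 < ‖x‖) (hy : 1 < ‖y‖) :
    HasMutualInfoRate μ (message a b U₁ U₂) (output μ (message a b U₁ U₂) Z)
      (ENNReal.ofReal (Real.log |b|)) := by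
  obtain ⟨hpos, hlim⟩ := (isLinearModel hZ hU hβ a b).tendsto_log_gramDet hβ hr hx hy
  refine (ENNReal.tendsto_ofReal hlim).congr' ?_
  filter_upwards [eventually_ge_atTop 2] with n hn
  have hn' : (0 : ℝ) < n := by exact_mod_cast (by omega : 0 < n)
  rw [mutualInfo_eq hZ hU a b hn (hpos n), ENNReal.ofReal_div_of_pos hn', ENNReal.ofReal_natCast]

theorem Feasible.achieves (hβ : IsARParam β) {P a b : ℝ} {x y : ℂ} (h : Feasible β P a b x y) :
    Achieves μ Z U₁ U₂ a b P (rate x y) := by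
  obtain ⟨-, hr, hx, hy, hp⟩ := h
  refine ⟨?_, _, hasMutualInfoRate hZ hU hβ hr hx hy,
    ENNReal.ofReal_le_ofReal (rate_le_log hr hx hy)⟩
  rw [asympPower_eq hZ hU hβ hr hx hy]
  exact ENNReal.ofReal_le_ofReal hp

end Scheme

end SK2

theorem theorem2 {p : ℕ} (β : Fin p → ℂ) (hβ : SK2.IsARParam β)
    {Ω : Type*} [MeasurableSpace Ω] (μ : Measure Ω) [IsProbabilityMeasure μ]
    (Z : ℕ → Ω → ℝ) (hZ : SK2.IsARNoise μ β Z)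
    (U₁ U₂ : Ω → ℝ) (hU : SK2.IsMessage μ Z U₁ U₂)
    (P : ℝ) (hP : 0 < P) :
    -- every feasible pair of characteristic roots gives a scheme that achieves its rate
    (∀ (a b : ℝ) (γ₁ γ₂ : ℂ), SK2.Feasible β P a b γ₁ γ₂ →
      SK2.Achieves μ Z U₁ U₂ a b P (SK2.rate γ₁ γ₂)) ∧
    -- the maximum over the feasible pairs exists, and some scheme with `b ≠ 0` achieves it
    (∃ R : ℝ, IsGreatest (SK2.feasibleRates β P) R ∧
      ∃ a b : ℝ, b ≠ 0 ∧ SK2.Achieves μ Z U₁ U₂ a b P R) ∧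
    -- for distinct roots of a real recursion the power expression is a real number
    (∀ (a b : ℝ) (γ₁ γ₂ : ℂ), SK2.AreCharRoots a b γ₁ γ₂ → 1 < ‖γ₁‖ → 1 < ‖γ₂‖ → γ₁ ≠ γ₂ →
      SK2.powerExpr β γ₁ γ₂ = (SK2.power β γ₁ γ₂ : ℂ)) ∧
    -- for a repeated root its value is the limit of the expression for distinct roots
    (∀ γ : ℝ, 1 < |γ| →
      Tendsto (fun z : ℂ => SK2.powerExpr β z (γ : ℂ)) (𝓝[≠] (γ : ℂ))
        (𝓝 (SK2.power β (γ : ℂ) (γ : ℂ) : ℂ))) := by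
  refine ⟨fun a b γ₁ γ₂ h => SK2.Feasible.achieves hZ hU hβ h, ?_,
    fun a b γ₁ γ₂ h h₁ h₂ hne => SK2.powerExpr_eq_power hβ h h₁ h₂ hne,
    fun γ hγ => SK2.tendsto_powerExpr hβ hγ⟩
  obtain ⟨R, hR⟩ := SK2.exists_isGreatest hβ hP
  obtain ⟨a, b, γ₁, γ₂, hf, hfR⟩ := hR.1
  refine ⟨R, hR, a, b, hf.1, ?_⟩
  rw [hfR]
  exact SK2.Feasible.achieves hZ hU hβ hf
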